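/- **Proposition (Capital injection policy).** Let $c,a,b,\eta,\rho>0$, $\delta>1$ and $y\ge b$. On a probability space $(\Omega,\mathcal F,\mathbb P)$ with a complete and right-continuous filtration $\mathbb F=(\mathcal F_t)_{t\ge 0}$, let $N$ be an adapted counting process ($N_0=0$, unit jumps) whose $\mathbb F$-intensity $\lambda$ solves $d\lambda_t=a(b-\lambda_t)\,dt+\eta\,dN_t$, $\lambda_0=y$, and let $(Y_k)_{k\ge 1}$ be positive i.i.d. claim sizes with a density, independent of $N$, such that $\sum_{k\le N_t}Y_k$ is adapted. For $x\in\mathbb R$ put $R^x_t=x+ct-\sum_{k=1}^{N_t}Y_k$. A strategy $\alpha=(Z,K)$ consists of adapted non-decreasing processes with $Z_{0^-}=K_{0^-}=0$, $Z$ càdlàg (cumulative dividends) and $K$ càglàd (cumulative capital injections). The surplus is $X_t=R^x_t-Z_t+K_t$, with $X_{0^-}=x$ and $R^0_{0^-}=0$; because $K$ is left-continuous, $X_t$ is the surplus just before, and $X_{t^+}$ the surplus just after, an injection made at time $t$. The strategy is admissible for $x$ if $Z_t-Z_{t^-}\le \big(X_{t^-}+R^0_t-R^0_{t^-}\big)^+$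 for all $t\ge 0$. Let $T^\alpha=\inf\{t\ge 0: X_{t^+}<0\}$ be the ruin time, $$J_\alpha(x,y)=\mathbb E\Big[\int_{[0,T^\alpha]}e^{-\rho s}\,dZ_s-\delta\int_{[0,T^\alpha]}e^{-\rho s}\,dK_s\Big],$$ where the time integrals run over $s<\infty$ and $J_\alpha(x,y)=-\infty$ if the expected discounted injections are infinite, and let $v(x,y)=\sup_\alpha J_\alpha(x,y)$ over all admissible $\alpha$. Then injecting capital is optimal only when it is strictly necessary to prevent ruin: 1. for all $x\ge 0$ and $\kappa>0$, $$v(x+\kappa,y)-\delta\kappa<v(x,y);$$ 2. for every $x\in\mathbb R$ and every optimal strategy $\alpha=(Z,K)$, that is, every admissible $\alpha$ with $J_\alpha(x,y)=v(x,y)$, almost surely, for $dK$-almost every $t\in[0,T^\alpha]$, one has $X_t<0$ and $X_{t^+}=0$. So up to ruin capital is injected only at times $t$ at which the surplus is negative before the injection, and the injection brings the surplus exactly to $0$. -/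

import Mathlib

open MeasureTheory ProbabilityTheory Set
open scoped NNReal ENNReal

/-- The constants of the model: premium rate `c`, mean-reversion speed `a`, long-term intensity
level `b`, excitation size `η`, discount rate `ρ` and proportional injection cost `δ`. -/
structure RiskParams where
  c : ℝ
  a : ℝ
  b : ℝ
  η : ℝ
  ρ : ℝ
  δ : ℝ
  c_pos : 0 < c
  a_pos : 0 < a
  b_pos : 0 < b
  η_pos : 0 < η
  ρ_pos : 0 < ρ
  one_lt_δ : 1 < δ

/-- Claims arriving according to a Hawkes process with exponential kernel and initial intensity
`y`, on a probability space `(Ω, P)` with a complete right-continuous filtration `𝔽`.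
`Y k` is the size of the `(k + 1)`-st claim. -/
structure HawkesClaims (p : RiskParams) (y : ℝ) {Ω : Type*} [m : MeasurableSpace Ω]
    (P : Measure Ω) (𝔽 : Filtration ℝ≥0 m) where
  /-- number of claims up to time `t` -/
  N : ℝ≥0 → Ω → ℕ
  /-- claim sizes -/
  Y : ℕ → Ω → ℝ
  /-- claim arrival intensity -/
  intensity : ℝ≥0 → Ω → ℝ
  filtration_rightContinuous : 𝔽.IsRightContinuous
  filtration_complete : ∀ s : Set Ω, P s = 0 → MeasurableSet[𝔽 0] s
  -- `N` is a counting process: from `0`, càdlàg, with jumps of size one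
  N_zero : ∀ ω, N 0 ω = 0
  N_mono : ∀ ω, Monotone fun t => N t ω
  N_rightContinuous : ∀ ω t, ContinuousWithinAt (fun s => N s ω) (Ici t) t
  N_jump : ∀ ω t, 0 < t → N t ω ≤ Function.leftLim (fun s => N s ω) t + 1
  N_adapted : Adapted 𝔽 N
  -- `dλ = a (b - λ) dt + η dN` with `λ₀ = y`
  intensity_integrable : ∀ ω (t : ℝ≥0),
    IntervalIntegrable (fun s : ℝ => intensity s.toNNReal ω) volume 0 t
  intensity_eq : ∀ ω (t : ℝ≥0), intensity t ω =
    y + (∫ s in (0 : ℝ)..t, p.a * (p.b - intensity s.toNNReal ω)) + p.η * (N t ω : ℝ)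
  -- `λ` is the `𝔽`-intensity of `N`
  intensity_compensates : Martingale
    (fun (t : ℝ≥0) ω => (N t ω : ℝ) - ∫ s in (0 : ℝ)..t, intensity s.toNNReal ω) 𝔽 P
  -- the claim sizes are positive, i.i.d. with a density, and independent of `N`
  Y_measurable : ∀ k, Measurable (Y k)
  Y_pos : ∀ k ω, 0 < Y k ω
  Y_density : ∃ f : ℝ → ℝ≥0∞, Measurable f ∧ ∀ k, P.map (Y k) = volume.withDensity f
  Y_indep : iIndepFun Y P
  Y_indep_N : IndepFun (fun ω k => Y k ω) (fun ω t => N t ω) P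
  claims_adapted : Adapted 𝔽 fun t ω => ∑ k ∈ Finset.range (N t ω), Y k ω

/-- A pair of cumulative dividend (`Z`) and capital injection (`K`) processes: `Z` is
non-decreasing and càdlàg with `Z_{0-} = 0`; `K` is non-decreasing and càglàd with `K_{0-} = 0`
(so that `K₀ = 0`, and an injection made at time `0` appears in `K_{0+}`). -/
structure Strategy (Ω : Type*) where
  Z : ℝ≥0 → Ω → ℝ
  K : ℝ≥0 → Ω → ℝ
  Z_mono : ∀ ω, Monotone fun t => Z t ω
  Z_rightContinuous : ∀ ω t, ContinuousWithinAt (fun s => Z s ω) (Ici t) t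
  Z_zero_nonneg : ∀ ω, 0 ≤ Z 0 ω
  K_mono : ∀ ω, Monotone fun t => K t ω
  K_leftContinuous : ∀ ω t, ContinuousWithinAt (fun s => K s ω) (Iic t) t
  K_zero : ∀ ω, K 0 ω = 0

/-- The left limit `g_{t-}` of a path on `[0, ∞)`, where `g_{0-}` is the prescribed value `g₀`. -/
noncomputable def prelimit (g₀ : ℝ) (g : ℝ≥0 → ℝ) (t : ℝ≥0) : ℝ :=
  if t = 0 then g₀ else Function.leftLim g t

/-- A path on `[0, ∞)`, extended by `0` to negative times. -/
noncomputable def extendZero (g : ℝ≥0 → ℝ) (t : ℝ) : ℝ :=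
  if t < 0 then 0 else g t.toNNReal

theorem extendZero_mono {g : ℝ≥0 → ℝ} (hg : Monotone g) (h0 : 0 ≤ g 0) :
    Monotone (extendZero g) := by
  intro s t hst
  unfold extendZero
  split_ifs with hs ht ht
  · exact le_rfl
  · exact h0.trans (hg zero_le)
  · exact absurd (hst.trans_lt ht) hs
  · exact hg (Real.toNNReal_mono hst)

/-- The Lebesgue-Stieltjes measure `dg` of a non-decreasing path with `g_{0-} = 0`. It satisfies
`dg [0, t] = g_{t+}`; in particular its atom at `0` is `g_{0+}`. -/
noncomputable def pathMeasure {g : ℝ≥0 → ℝ} (hg : Monotone g) (h0 : 0 ≤ g 0) : Measure ℝ :=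
  (extendZero_mono hg h0).stieltjesFunction.measure

namespace Strategy

variable {Ω : Type*}

/-- The measure `dZ` on the time axis. -/
noncomputable def dZ (α : Strategy Ω) (ω : Ω) : Measure ℝ :=
  pathMeasure (α.Z_mono ω) (α.Z_zero_nonneg ω)

/-- The measure `dK` on the time axis. -/
noncomputable def dK (α : Strategy Ω) (ω : Ω) : Measure ℝ :=
  pathMeasure (α.K_mono ω) (α.K_zero ω).ge

end Strategy

namespace HawkesClaims

variable {p : RiskParams} {y : ℝ} {Ω : Type*} [m : MeasurableSpace Ω] {P : Measure Ω}
  {𝔽 : Filtration ℝ≥0 m}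

/-- The uncontrolled surplus `R^x_t = x + c t - ∑_{k ≤ N_t} Y_k`. -/
noncomputable def reserve (M : HawkesClaims p y P 𝔽) (x : ℝ) (t : ℝ≥0) (ω : Ω) : ℝ :=
  x + p.c * t - ∑ k ∈ Finset.range (M.N t ω), M.Y k ω

/-- The controlled surplus `X_t = R^x_t - Z_t + K_t`. As `K` is left-continuous, `X_t` does not
yet contain a lump-sum injection made at time `t`, whereas `X_{t+}` does. -/
noncomputable def surplus (M : HawkesClaims p y P 𝔽) (x : ℝ) (α : Strategy Ω)
    (t : ℝ≥0) (ω : Ω) : ℝ :=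
  M.reserve x t ω - α.Z t ω + α.K t ω

/-- The surplus `X_{t+}` immediately after time `t`. -/
noncomputable def surplusAfter (M : HawkesClaims p y P 𝔽) (x : ℝ) (α : Strategy Ω)
    (t : ℝ≥0) (ω : Ω) : ℝ :=
  Function.rightLim (fun s => M.surplus x α s ω) t

/-- Admissible strategies: adapted, and a lump-sum dividend never exceeds the available reserve,
`Z_t - Z_{t-} ≤ (X_{t-} + R⁰_t - R⁰_{t-})⁺`, with `Z_{0-} = 0`, `X_{0-} = x`, `R⁰_{0-} = 0`. -/
structure IsAdmissible (M : HawkesClaims p y P 𝔽) (x : ℝ) (α : Strategy Ω) : Prop where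
  Z_adapted : Adapted 𝔽 α.Z
  K_adapted : Adapted 𝔽 α.K
  dividend_le : ∀ ω t,
    α.Z t ω - prelimit 0 (fun s => α.Z s ω) t ≤
      max 0 (prelimit x (fun s => M.surplus x α s ω) t
        + M.reserve 0 t ω - prelimit 0 (fun s => M.reserve 0 s ω) t)

/-- The ruin time `T = inf {t ≥ 0 : X_{t+} < 0}`, infinite if there is no such `t`. -/
noncomputable def ruinTime (M : HawkesClaims p y P 𝔽) (x : ℝ) (α : Strategy Ω) (ω : Ω) : ℝ≥0∞ :=
  sInf {s | ∃ t : ℝ≥0, s = t ∧ M.surplusAfter x α t ω < 0}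

/-- The expected discounted dividends `E ∫_{[0,T]} e^{-ρ s} dZ_s`. -/
noncomputable def expectedDividends (M : HawkesClaims p y P 𝔽) (x : ℝ) (α : Strategy Ω) : ℝ≥0∞ :=
  ∫⁻ ω, ∫⁻ s in {s : ℝ | ENNReal.ofReal s ≤ M.ruinTime x α ω},
    ENNReal.ofReal (Real.exp (-p.ρ * s)) ∂(α.dZ ω) ∂P

/-- The expected discounted injections `E ∫_{[0,T]} e^{-ρ s} dK_s`. -/
noncomputable def expectedInjections (M : HawkesClaims p y P 𝔽) (x : ℝ) (α : Strategy Ω) : ℝ≥0∞ :=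
  ∫⁻ ω, ∫⁻ s in {s : ℝ | ENNReal.ofReal s ≤ M.ruinTime x α ω},
    ENNReal.ofReal (Real.exp (-p.ρ * s)) ∂(α.dK ω) ∂P

/-- The reward `J_α(x, y)`. A strategy with infinite expected injection cost has reward `-∞`
(in `EReal`, `⊤ - ⊤ = ⊥`). -/
noncomputable def reward (M : HawkesClaims p y P 𝔽) (x : ℝ) (α : Strategy Ω) : EReal :=
  (M.expectedDividends x α : EReal) - (p.δ : EReal) * (M.expectedInjections x α : EReal)

/-- The value function `v(x, y)`, the supremum of the reward over the admissible strategies. -/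
noncomputable def value (M : HawkesClaims p y P 𝔽) (x : ℝ) : EReal :=
  ⨆ (α : Strategy Ω) (_ : M.IsAdmissible x α), M.reward x α

end HawkesClaims

/-! Injections cost $\delta>1$ per unit and the reserve only grows between claims, so an injection
not needed to cover the current shortfall is better postponed to the next claim. Let $\alpha$ be
admissible for $x+\kappa$, let $\tau$ and $\sigma$ be the times of the $n$-th and $(n+1)$-st claims,
and let $k_t$ be $\kappa$ plus whatever $\alpha$ injects after $\tau$ beyond the shortfall
$X_\tau^-$. The modified strategy `defer` starts from $x$. Up to $\sigma$ it injects $K+\kappa-k$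
and pays $M_t=\sup_{s\le t}(Z_s-k_s)^+$ as dividends. Right after $\sigma$ it catches up by
injecting $k_\sigma-(Z_\sigma-M_\sigma)$, and from then on its surplus is that of $\alpha$.

It stays solvent as long as $\alpha$ does (`surplusAfter_defer_nonneg`): once the shortfall at
$\tau$ is covered, the growing reserve pays for $M$. This needs $\kappa=0$, or $n=0$ and $x\ge 0$.
Its cumulative flows beat those of $\alpha$ at every time, by at least $(\delta-1)k_t$ for
$t\le\sigma$ (`add_le_deferred`). Discounting at rate $\rho$ amounts to reading cumulative flows at
an independent exponential clock (`lintegral_exp_eq_lintegral_discountMeasure`), so pathwise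
domination turns into a comparison of rewards (`exists_improvement`). Stopping the modified strategy
at the ruin time of $\alpha$ also saves any lump sum that $\alpha$ injects at ruin.

For the first claim take $n=0$ and $\kappa>0$: the gain is at least $(\delta-1)\kappa$ on the event
that the clock rings before the first claim, a positive bound independent of $\alpha$, which
survives the supremum. For the second take $\kappa=0$ and $\alpha$ optimal: the gain vanishes for
every $n$, so almost surely between two claims nothing is injected beyond the shortfall at the
earlier one, and nothing at ruin. Solvency forces at least that shortfall to be injected,
immediately after the claim. Much of the remaining work shows that the modified strategies are
adapted. -/

open Filter Topology

/-! ### Stopped times -/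

/-- The minimum `t ∧ T` of a finite time `t` and a possibly infinite time `T`. -/
noncomputable def stopTime (T : ℝ≥0∞) (t : ℝ≥0) : ℝ≥0 := (min (t : ℝ≥0∞) T).toNNReal

theorem coe_stopTime (T : ℝ≥0∞) (t : ℝ≥0) : (stopTime T t : ℝ≥0∞) = min (t : ℝ≥0∞) T :=
  ENNReal.coe_toNNReal (ne_top_of_le_ne_top ENNReal.coe_ne_top (min_le_left _ _))

theorem stopTime_le (T : ℝ≥0∞) (t : ℝ≥0) : stopTime T t ≤ t := by
  rw [← ENNReal.coe_le_coe, coe_stopTime]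
  exact min_le_left _ _

theorem coe_stopTime_le (T : ℝ≥0∞) (t : ℝ≥0) : (stopTime T t : ℝ≥0∞) ≤ T := by
  rw [coe_stopTime]
  exact min_le_right _ _

theorem stopTime_of_le {T : ℝ≥0∞} {t : ℝ≥0} (h : (t : ℝ≥0∞) ≤ T) : stopTime T t = t := by
  simp [stopTime, h]

theorem coe_stopTime_of_ge {T : ℝ≥0∞} {t : ℝ≥0} (h : T ≤ t) : (stopTime T t : ℝ≥0∞) = T := by
  rw [coe_stopTime, min_eq_right h]

theorem stopTime_top (t : ℝ≥0) : stopTime ⊤ t = t := stopTime_of_le le_top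

theorem stopTime_coe (s t : ℝ≥0) : stopTime s t = min t s := by
  rw [← ENNReal.coe_inj, coe_stopTime, ENNReal.coe_min]

theorem stopTime_mono (T : ℝ≥0∞) : Monotone (stopTime T) := by
  intro s t h
  rw [← ENNReal.coe_le_coe, coe_stopTime, coe_stopTime]
  exact min_le_min_right _ (ENNReal.coe_le_coe.2 h)

theorem continuous_stopTime (T : ℝ≥0∞) : Continuous (stopTime T) := by
  induction T with
  | top => exact (funext stopTime_top : stopTime ⊤ = id) ▸ continuous_id
  | coe s =>
    rw [funext (stopTime_coe s)]
    exact continuous_id.min continuous_const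

theorem stopTime_zero (T : ℝ≥0∞) : stopTime T 0 = 0 := stopTime_of_le (by simp)

theorem le_stopTime {T : ℝ≥0∞} {s t : ℝ≥0} (hst : s ≤ t) (hs : (s : ℝ≥0∞) ≤ T) :
    s ≤ stopTime T t := by
  rw [← stopTime_of_le hs]
  exact stopTime_mono T hst

theorem ContinuousWithinAt.comp_stopTime_right {g : ℝ≥0 → ℝ} {T : ℝ≥0∞} {t : ℝ≥0}
    (hg : ContinuousWithinAt g (Ici (stopTime T t)) (stopTime T t)) :
    ContinuousWithinAt (fun s => g (stopTime T s)) (Ici t) t :=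
  ContinuousWithinAt.comp hg (continuous_stopTime T).continuousWithinAt
    fun _ hs => stopTime_mono T hs

theorem ContinuousWithinAt.comp_stopTime_left {g : ℝ≥0 → ℝ} {T : ℝ≥0∞} {t : ℝ≥0}
    (hg : ContinuousWithinAt g (Iic (stopTime T t)) (stopTime T t)) :
    ContinuousWithinAt (fun s => g (stopTime T s)) (Iic t) t :=
  ContinuousWithinAt.comp hg (continuous_stopTime T).continuousWithinAt
    fun _ hs => stopTime_mono T hs

/-! ### One-sided limits of paths -/

theorem ContinuousWithinAt.leftLim_eq_of_Iic {g : ℝ≥0 → ℝ} {t : ℝ≥0}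
    (hg : ContinuousWithinAt g (Iic t) t) : Function.leftLim g t = g t := by
  by_cases h : 𝓝[<] t = ⊥
  · exact leftLim_eq_of_eq_bot _ h
  · have : (𝓝[<] t).NeBot := ⟨h⟩
    exact leftLim_eq_of_tendsto (hg.mono Iio_subset_Iic_self)

theorem ContinuousWithinAt.rightLim_eq_of_Ici {g : ℝ≥0 → ℝ} {t : ℝ≥0}
    (hg : ContinuousWithinAt g (Ici t) t) : Function.rightLim g t = g t :=
  rightLim_eq_of_tendsto (hg.mono Ioi_subset_Ici_self)

theorem neBot_nhdsLT {t : ℝ≥0} (ht : t ≠ 0) : (𝓝[<] t).NeBot :=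
  nhdsLT_neBot_of_exists_lt ⟨0, pos_iff_ne_zero.2 ht⟩

theorem prelimit_zero (g₀ : ℝ) (g : ℝ≥0 → ℝ) : prelimit g₀ g 0 = g₀ := if_pos rfl

theorem prelimit_eq_of_tendsto {g₀ l : ℝ} {g : ℝ≥0 → ℝ} {t : ℝ≥0} (ht : t ≠ 0)
    (h : Tendsto g (𝓝[<] t) (𝓝 l)) : prelimit g₀ g t = l := by
  have := neBot_nhdsLT ht
  rw [prelimit, if_neg ht]
  exact leftLim_eq_of_tendsto h

theorem prelimit_congr {g₀ : ℝ} {g h : ℝ≥0 → ℝ} {t : ℝ≥0} {l : ℝ} 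
    (hl : t ≠ 0 → Tendsto g (𝓝[<] t) (𝓝 l))
    (hgh : ∀ s < t, h s = g s) : prelimit g₀ h t = prelimit g₀ g t := by
  by_cases ht : t = 0
  · rw [ht, prelimit_zero, prelimit_zero]
  · rw [prelimit_eq_of_tendsto ht (hl ht)]
    refine prelimit_eq_of_tendsto ht ((hl ht).congr' ?_)
    filter_upwards [self_mem_nhdsWithin] with s hs using (hgh s hs).symm

/-! ### The Stieltjes measure of a path -/

theorem extendZero_of_neg (g : ℝ≥0 → ℝ) {t : ℝ} (ht : t < 0) : extendZero g t = 0 := if_pos ht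

theorem tendsto_extendZero_right {g : ℝ≥0 → ℝ} {l : ℝ} {u : ℝ≥0}
    (h : Tendsto g (𝓝[>] u) (𝓝 l)) : Tendsto (extendZero g) (𝓝[>] (u : ℝ)) (𝓝 l) := by
  have h1 : Tendsto Real.toNNReal (𝓝[>] (u : ℝ)) (𝓝[>] u) := by
    refine tendsto_nhdsWithin_iff.2 ⟨?_, ?_⟩
    · have := (continuous_real_toNNReal.tendsto (u : ℝ)).mono_left
        (nhdsWithin_le_nhds (s := Ioi (u : ℝ)))
      simpa using this
    · filter_upwards [self_mem_nhdsWithin] with s hs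
      exact Real.lt_toNNReal_iff_coe_lt.2 hs
  refine (h.comp h1).congr' ?_
  filter_upwards [self_mem_nhdsWithin] with s hs
  have : ¬ s < 0 := not_lt.2 (u.2.trans (le_of_lt hs))
  simp [extendZero, this]

theorem tendsto_extendZero_left {g : ℝ≥0 → ℝ} {l : ℝ} {u : ℝ≥0} (hu : u ≠ 0)
    (h : Tendsto g (𝓝[<] u) (𝓝 l)) : Tendsto (extendZero g) (𝓝[<] (u : ℝ)) (𝓝 l) := by
  have hu' : (0 : ℝ) < u := NNReal.coe_pos.2 (pos_iff_ne_zero.2 hu)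
  have h1 : Tendsto Real.toNNReal (𝓝[<] (u : ℝ)) (𝓝[<] u) := by
    refine tendsto_nhdsWithin_iff.2 ⟨?_, ?_⟩
    · have := (continuous_real_toNNReal.tendsto (u : ℝ)).mono_left
        (nhdsWithin_le_nhds (s := Iio (u : ℝ)))
      simpa using this
    · filter_upwards [self_mem_nhdsWithin] with s hs
      rw [mem_Iio, ← NNReal.coe_lt_coe, Real.coe_toNNReal']
      exact max_lt hs hu'
  refine (h.comp h1).congr' ?_
  filter_upwards [self_mem_nhdsWithin, mem_nhdsWithin_of_mem_nhds (lt_mem_nhds hu')] with s _ hs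
  have : ¬ s < 0 := not_lt.2 hs.le
  simp [extendZero, this]

section PathMeasure

variable {g : ℝ≥0 → ℝ} (hg : Monotone g) (h0 : 0 ≤ g 0)

theorem tendsto_stieltjesFunction_extendZero_atBot :
    Tendsto (extendZero_mono hg h0).stieltjesFunction atBot (𝓝 0) := by
  refine tendsto_const_nhds.congr' ?_
  filter_upwards [Iio_mem_atBot (0 : ℝ)] with s hs
  rw [Monotone.stieltjesFunction_eq]
  refine (rightLim_eq_of_tendsto (tendsto_const_nhds.congr' ?_)).symm
  filter_upwards [mem_nhdsWithin_of_mem_nhds (Iio_mem_nhds hs)] with r hr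
    using (extendZero_of_neg g hr).symm

theorem pathMeasure_Iic (u : ℝ≥0) :
    pathMeasure hg h0 (Iic (u : ℝ)) = ENNReal.ofReal (Function.rightLim g u) := by
  rw [pathMeasure, StieltjesFunction.measure_Iic _
    (tendsto_stieltjesFunction_extendZero_atBot hg h0), Monotone.stieltjesFunction_eq,
    rightLim_eq_of_tendsto (tendsto_extendZero_right (hg.tendsto_rightLim u)), sub_zero]

/-- For $s<x$ the right limit at $s$ lies between the value at $s$ and the left limit at $x$, so
passing to right limits does not change left limits. -/
theorem leftLim_stieltjesFunction_extendZero (x : ℝ) :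
    Function.leftLim (extendZero_mono hg h0).stieltjesFunction x =
      Function.leftLim (extendZero g) x := by
  have hm := extendZero_mono hg h0
  refine le_antisymm ?_ ?_
  · refine le_of_tendsto (hm.stieltjesFunction.mono.tendsto_leftLim x) ?_
    filter_upwards [self_mem_nhdsWithin] with s hs
    rw [Monotone.stieltjesFunction_eq]
    exact hm.rightLim_le_leftLim hs
  · refine le_of_tendsto_of_tendsto (hm.tendsto_leftLim x)
      (hm.stieltjesFunction.mono.tendsto_leftLim x) (Eventually.of_forall fun s => ?_)
    rw [Monotone.stieltjesFunction_eq]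
    exact hm.le_rightLim le_rfl

theorem pathMeasure_Iio_zero : pathMeasure hg h0 (Iio 0) = 0 := by
  rw [pathMeasure, StieltjesFunction.measure_Iio _
    (tendsto_stieltjesFunction_extendZero_atBot hg h0), leftLim_stieltjesFunction_extendZero hg h0,
    leftLim_eq_of_tendsto (y := 0), sub_zero, ENNReal.ofReal_zero]
  refine tendsto_const_nhds.congr' ?_
  filter_upwards [self_mem_nhdsWithin] with r hr using (extendZero_of_neg g hr).symm

theorem pathMeasure_Iio {u : ℝ≥0} (hu : u ≠ 0) :
    pathMeasure hg h0 (Iio (u : ℝ)) = ENNReal.ofReal (Function.leftLim g u) := by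
  rw [pathMeasure, StieltjesFunction.measure_Iio _
    (tendsto_stieltjesFunction_extendZero_atBot hg h0), leftLim_stieltjesFunction_extendZero hg h0,
    leftLim_eq_of_tendsto (tendsto_extendZero_left hu (hg.tendsto_leftLim u)), sub_zero]

theorem pathMeasure_Iio_of_leftContinuous (hc : ∀ t, ContinuousWithinAt g (Iic t) t)
    (hz : g 0 = 0) (u : ℝ≥0) : pathMeasure hg h0 (Iio (u : ℝ)) = ENNReal.ofReal (g u) := by
  by_cases hu : u = 0
  · rw [hu, NNReal.coe_zero, pathMeasure_Iio_zero, hz, ENNReal.ofReal_zero]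
  · rw [pathMeasure_Iio hg h0 hu, (hc u).leftLim_eq_of_Iic]

theorem pathMeasure_Iic_of_rightContinuous (hc : ∀ t, ContinuousWithinAt g (Ici t) t)
    (u : ℝ≥0) : pathMeasure hg h0 (Iic (u : ℝ)) = ENNReal.ofReal (g u) := by
  rw [pathMeasure_Iic, (hc u).rightLim_eq_of_Ici]

instance : SFinite (pathMeasure hg h0) := by
  unfold pathMeasure
  infer_instance

end PathMeasure

/-! ### Discounting -/

/-- The law of an exponential time with rate `ρ` on `ℝ≥0`. -/
noncomputable def discountMeasure (ρ : ℝ) : Measure ℝ≥0 :=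
  ((volume.restrict (Ioi (0 : ℝ))).withDensity
    fun u => ENNReal.ofReal (ρ * Real.exp (-ρ * u))).map Real.toNNReal

theorem lintegral_discountMeasure (ρ : ℝ) {f : ℝ≥0 → ℝ≥0∞} (hf : Measurable f) :
    ∫⁻ u, f u ∂discountMeasure ρ =
      ∫⁻ u in Ioi (0 : ℝ), ENNReal.ofReal (ρ * Real.exp (-ρ * u)) * f u.toNNReal := by
  rw [discountMeasure, lintegral_map hf measurable_real_toNNReal,
    lintegral_withDensity_eq_lintegral_mul _ (by fun_prop)
      (show Measurable fun u : ℝ => f u.toNNReal from hf.comp measurable_real_toNNReal)]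
  rfl

theorem lintegral_exp_Ioi {ρ : ℝ} (hρ : 0 < ρ) (s : ℝ) :
    ∫⁻ u in Ioi s, ENNReal.ofReal (ρ * Real.exp (-ρ * u)) = ENNReal.ofReal (Real.exp (-ρ * s)) := by
  have hi : IntegrableOn (fun u => ρ * Real.exp (-ρ * u)) (Ioi s) :=
    (integrableOn_exp_mul_Ioi (neg_lt_zero.2 hρ) s).const_mul ρ
  rw [← ofReal_integral_eq_lintegral_ofReal hi
    (Eventually.of_forall fun u => by positivity), integral_const_mul,
    integral_exp_mul_Ioi (neg_lt_zero.2 hρ)]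
  congr 1
  field_simp

theorem discountMeasure_Ioi {ρ : ℝ} (hρ : 0 < ρ) (s : ℝ≥0) :
    discountMeasure ρ (Ioi s) = ENNReal.ofReal (Real.exp (-ρ * s)) := by
  have h1 := lintegral_discountMeasure ρ (f := (Ioi s).indicator 1)
    (measurable_one.indicator measurableSet_Ioi)
  rw [lintegral_indicator_one measurableSet_Ioi] at h1
  rw [h1, ← lintegral_exp_Ioi hρ, ← lintegral_indicator measurableSet_Ioi,
    ← lintegral_indicator measurableSet_Ioi]
  refine lintegral_congr fun u => ?_
  by_cases hu : (s : ℝ) < u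
  · have hu0 : 0 < u := s.2.trans_lt hu
    simp [indicator, hu, hu0, Real.lt_toNNReal_iff_coe_lt]
  · simp [indicator, hu, Real.lt_toNNReal_iff_coe_lt]

theorem discountMeasure_singleton (ρ : ℝ) (s : ℝ≥0) : discountMeasure ρ {s} = 0 := by
  have hs := measurable_real_toNNReal (measurableSet_singleton s)
  rw [discountMeasure, Measure.map_apply measurable_real_toNNReal (measurableSet_singleton s),
    withDensity_apply _ hs, Measure.restrict_restrict hs]
  refine setLIntegral_measure_zero _ _ (measure_mono_null (t := {(s : ℝ)}) ?_ (by simp))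
  rintro u ⟨hu, hu0⟩
  rw [mem_singleton_iff, ← (show u.toNNReal = s from hu), Real.coe_toNNReal u (le_of_lt hu0)]

theorem discountMeasure_univ {ρ : ℝ} (hρ : 0 < ρ) : discountMeasure ρ univ = 1 := by
  have h : (univ : Set ℝ≥0) = {0} ∪ Ioi 0 := by
    ext u
    simp
  rw [h, measure_union (by simp) measurableSet_Ioi, discountMeasure_singleton, discountMeasure_Ioi hρ]
  simp

theorem isProbabilityMeasure_discountMeasure {ρ : ℝ} (hρ : 0 < ρ) :
    IsProbabilityMeasure (discountMeasure ρ) := ⟨discountMeasure_univ hρ⟩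

/-- A null interval would make two tails $e^{-\rho s}$, $e^{-\rho r}$ with $s<r$ comparable the
wrong way. Consequently an almost sure statement about the clock holds at some point of every
interval. -/
theorem discountMeasure_Ioo_pos {ρ : ℝ} (hρ : 0 < ρ) {s t : ℝ≥0} (hst : s < t) :
    0 < discountMeasure ρ (Ioo s t) := by
  rw [pos_iff_ne_zero]
  intro h
  obtain ⟨r, hsr, hrt⟩ := exists_between hst
  have h1 : discountMeasure ρ (Ioi s) ≤ discountMeasure ρ (Ioi r) := by
    calc discountMeasure ρ (Ioi s) ≤ discountMeasure ρ (Ioo s t ∪ Ioi r) := by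
          refine measure_mono fun u hu => ?_
          rcases lt_or_ge u t with h | h
          · exact Or.inl ⟨hu, h⟩
          · exact Or.inr (hrt.trans_le h)
      _ ≤ _ := (measure_union_le _ _).trans (by rw [h, zero_add])
  rw [discountMeasure_Ioi hρ, discountMeasure_Ioi hρ,
    ENNReal.ofReal_le_ofReal_iff (Real.exp_pos _).le, Real.exp_le_exp] at h1
  have : (s : ℝ) < r := NNReal.coe_lt_coe.2 hsr
  nlinarith

theorem ae_discountMeasure_exists {ρ : ℝ} (hρ : 0 < ρ) {q : ℝ≥0 → Prop}
    (hq : ∀ᵐ u ∂discountMeasure ρ, q u) {s t : ℝ≥0} (hst : s < t) : ∃ u ∈ Ioo s t, q u := by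
  by_contra! h
  exact (discountMeasure_Ioo_pos hρ hst).ne' (measure_mono_null (fun u hu => h u hu) hq)

theorem lintegral_coe_discountMeasure_lt_top {ρ : ℝ} (hρ : 0 < ρ) :
    ∫⁻ u, (u : ℝ≥0∞) ∂discountMeasure ρ < ⊤ := by
  rw [lintegral_discountMeasure ρ (by fun_prop)]
  have h := Real.GammaIntegral_convergent (s := 2) (by norm_num)
  have h2 := (integrableOn_Ioi_comp_mul_left_iff (fun x => Real.exp (-x) * x ^ ((2 : ℝ) - 1)) 0 hρ).2
    (by simpa using h)
  refine lt_of_le_of_lt (le_of_eq ?_) h2.lintegral_lt_top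
  refine setLIntegral_congr_fun measurableSet_Ioi fun u hu => ?_
  have hu' : (0 : ℝ) < u := hu
  rw [ENNReal.ofNNReal_toNNReal, ← ENNReal.ofReal_mul (by positivity)]
  congr 1
  norm_num
  ring

/-- Tonelli applied to $e^{-\rho s}=\mathbb P(\text{clock}>s)$. The diagonal is null for the clock,
so $S$ may be $\{s\le u\}$ or $\{s<u\}$: the former suits càdlàg dividends, the latter càglàd
injections. -/
theorem lintegral_exp_eq_lintegral_discountMeasure {ρ : ℝ} (hρ : 0 < ρ) (μ : Measure ℝ) [SFinite μ]
    (hμ : μ (Iio 0) = 0) {A : Set ℝ} (hA : MeasurableSet A) {S : Set (ℝ × ℝ)}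
    (hS : MeasurableSet S) (h1 : ∀ s u : ℝ, s < u → (s, u) ∈ S)
    (h2 : ∀ s u : ℝ, (s, u) ∈ S → s ≤ u) :
    ∫⁻ s in A, ENNReal.ofReal (Real.exp (-ρ * s)) ∂μ =
      ∫⁻ u : ℝ≥0, μ (A ∩ {s | (s, (u : ℝ)) ∈ S}) ∂discountMeasure ρ := by
  have := isProbabilityMeasure_discountMeasure hρ
  have hS' : MeasurableSet {x : ℝ × ℝ≥0 | (x.1, (x.2 : ℝ)) ∈ S} :=
    (show Measurable fun x : ℝ × ℝ≥0 => (x.1, (x.2 : ℝ)) by fun_prop) hS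
  have key := Measure.prod_apply (μ := μ.restrict A) (ν := discountMeasure ρ) hS'
  rw [Measure.prod_apply_symm hS'] at key
  calc _ = ∫⁻ s in A, discountMeasure ρ (Prod.mk s ⁻¹' {x : ℝ × ℝ≥0 | (x.1, (x.2 : ℝ)) ∈ S}) ∂μ := by
        refine lintegral_congr_ae ?_
        have hpos : ∀ᵐ s ∂μ, 0 ≤ s := measure_mono_null (fun s hs => by simpa using hs) hμ
        filter_upwards [ae_restrict_of_ae hpos] with s hs
        lift s to ℝ≥0 using hs
        rw [← discountMeasure_Ioi hρ]
        refine le_antisymm (measure_mono fun u hu => h1 _ _ (NNReal.coe_lt_coe.2 hu)) ?_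
        calc _ ≤ discountMeasure ρ ({s} ∪ Ioi s) := measure_mono fun u hu => by
              rcases (NNReal.coe_le_coe.1 (h2 _ _ hu)).eq_or_lt with h | h
              · exact Or.inl h.symm
              · exact Or.inr h
          _ ≤ _ := (measure_union_le _ _).trans (by rw [discountMeasure_singleton, zero_add])
    _ = _ := by
        rw [← key]
        refine lintegral_congr fun u => ?_
        rw [Measure.restrict_apply' hA, inter_comm]
        rfl

theorem measurableSet_ofReal_le (T : ℝ≥0∞) : MeasurableSet {s : ℝ | ENNReal.ofReal s ≤ T} :=
  ENNReal.measurable_ofReal measurableSet_Iic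

section Discounted

variable {g : ℝ≥0 → ℝ} (hg : Monotone g) (h0 : 0 ≤ g 0)

theorem lintegral_exp_pathMeasure_Iic {ρ : ℝ} (hρ : 0 < ρ) (T : ℝ≥0∞) :
    ∫⁻ s in {s : ℝ | ENNReal.ofReal s ≤ T}, ENNReal.ofReal (Real.exp (-ρ * s))
        ∂pathMeasure hg h0 =
      ∫⁻ u : ℝ≥0, pathMeasure hg h0 (Iic (stopTime T u : ℝ)) ∂discountMeasure ρ := by
  rw [lintegral_exp_eq_lintegral_discountMeasure hρ _ (pathMeasure_Iio_zero hg h0)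
    (measurableSet_ofReal_le T) (measurableSet_le measurable_fst measurable_snd)
    (fun _ _ h => le_of_lt h) (fun _ _ h => h)]
  refine lintegral_congr fun u => congrArg _ (Set.ext fun s => ?_)
  have h : (s.toNNReal : ℝ≥0∞) ≤ stopTime T u ↔ s ≤ stopTime T u := by
    rw [ENNReal.coe_le_coe, Real.toNNReal_le_iff_le_coe]
  rw [mem_Iic, ← h, coe_stopTime, le_min_iff, ENNReal.coe_le_coe, Real.toNNReal_le_iff_le_coe]
  exact and_comm

theorem lintegral_exp_pathMeasure_Iio {ρ : ℝ} (hρ : 0 < ρ) (T : ℝ≥0∞) :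
    ∫⁻ s in {s : ℝ | ENNReal.ofReal s ≤ T}, ENNReal.ofReal (Real.exp (-ρ * s))
        ∂pathMeasure hg h0 =
      ∫⁻ u : ℝ≥0, pathMeasure hg h0 ({s : ℝ | ENNReal.ofReal s ≤ T} ∩ Iio (u : ℝ))
        ∂discountMeasure ρ :=
  lintegral_exp_eq_lintegral_discountMeasure hρ _ (pathMeasure_Iio_zero hg h0)
    (measurableSet_ofReal_le T) (measurableSet_lt measurable_fst measurable_snd)
    (fun _ _ h => h) (fun _ _ h => le_of_lt h)

/-- The value `g_t` for `t ≤ T`, and `g_{T+}` for `t > T`. -/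
noncomputable def stopAfter (g : ℝ≥0 → ℝ) (T : ℝ≥0∞) (t : ℝ≥0) : ℝ :=
  if (t : ℝ≥0∞) ≤ T then g t else Function.rightLim g T.toNNReal

theorem le_stopAfter {g : ℝ≥0 → ℝ} (hg : Monotone g) (T : ℝ≥0∞) (t : ℝ≥0) :
    g (stopTime T t) ≤ stopAfter g T t := by
  unfold stopAfter
  split_ifs with h
  · rw [stopTime_of_le h]
  · rw [stopTime, min_eq_right (not_le.1 h).le]
    exact hg.le_rightLim le_rfl

/-- If $u\le T$ the set is $(-\infty,u)$, of mass $g_u$; otherwise it is $(-\infty,T]$ and includes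
the atom at $T$. -/
theorem pathMeasure_le_inter_Iio (hc : ∀ t, ContinuousWithinAt g (Iic t) t) (hz : g 0 = 0)
    (T : ℝ≥0∞) (u : ℝ≥0) :
    pathMeasure hg h0 ({s : ℝ | ENNReal.ofReal s ≤ T} ∩ Iio (u : ℝ)) =
      ENNReal.ofReal (stopAfter g T u) := by
  unfold stopAfter
  split_ifs with h
  · rw [← pathMeasure_Iio_of_leftContinuous hg h0 hc hz, inter_eq_right.2]
    intro s hs
    refine le_trans ?_ h
    rw [← ENNReal.ofReal_coe_nnreal]
    exact ENNReal.ofReal_le_ofReal (le_of_lt hs)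
  · rw [not_le] at h
    lift T to ℝ≥0 using h.ne_top
    rw [ENNReal.toNNReal_coe, ← pathMeasure_Iic hg h0]
    congr 1
    ext s
    have h1 : ENNReal.ofReal s ≤ T ↔ s ≤ T := by
      rw [ENNReal.ofReal, ENNReal.coe_le_coe, Real.toNNReal_le_iff_le_coe]
    simp only [mem_inter_iff, mem_ofPred_eq, mem_Iio, mem_Iic, h1, and_iff_left_iff_imp]
    exact fun hs => hs.trans_lt (NNReal.coe_lt_coe.2 (ENNReal.coe_lt_coe.1 h))

end Discounted

/-! ### Sampling a process at a random time -/

/-- The grid points are cut off at `t` so that only values known at time `t` are read; this yields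
adaptedness rather than mere measurability. -/
theorem measurable_eval_countable {Ω : Type*} {m : MeasurableSpace Ω} {f : ℝ≥0 → Ω → ℝ}
    {t : ℝ≥0∞} (hf : ∀ s : ℝ≥0, (s : ℝ≥0∞) ≤ t → Measurable (f s)) (e : ℕ → ℝ≥0) {k : Ω → ℕ}
    (hk : Measurable k) : Measurable fun ω => f (stopTime t (e (k ω))) ω := by
  have h : Measurable fun x : Ω × ℕ => f (stopTime t (e x.2)) x.1 :=
    measurable_from_prod_countable_left fun j => hf (stopTime t (e j)) (coe_stopTime_le _ _)
  exact h.comp (measurable_id.prodMk hk)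

theorem tendsto_floor_grid (x : ℝ≥0) :
    Tendsto (fun n : ℕ => (⌊((n : ℝ≥0) + 1) * x⌋₊ : ℝ≥0) / ((n : ℝ≥0) + 1)) atTop (𝓝 x) := by
  have h := (tendsto_nat_floor_mul_div_atTop (R := ℝ) (a := x) x.2).comp
    (tendsto_natCast_atTop_atTop.atTop_add tendsto_const_nhds (C := (1 : ℝ)) :
      Tendsto (fun n : ℕ => (n : ℝ) + 1) atTop atTop)
  rw [← NNReal.tendsto_coe]
  refine h.congr fun n => ?_
  have : ⌊((n : ℝ≥0) + 1) * x⌋₊ = ⌊(x : ℝ) * ((n : ℝ) + 1)⌋₊ := by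
    rw [mul_comm, Nat.floor_eq_iff zero_le]
    have h1 := Nat.floor_le (a := (x : ℝ) * ((n : ℝ) + 1)) (by positivity)
    have h2 := Nat.lt_floor_add_one ((x : ℝ) * ((n : ℝ) + 1))
    exact ⟨by exact_mod_cast h1, by exact_mod_cast h2⟩
  simp only [Function.comp_apply, NNReal.coe_div, NNReal.coe_natCast, NNReal.coe_add,
    NNReal.coe_one, this]

theorem tendsto_floor_add_one_grid (x : ℝ≥0) :
    Tendsto (fun n : ℕ => ((⌊((n : ℝ≥0) + 1) * x⌋₊ + 1 : ℕ) : ℝ≥0) / ((n : ℝ≥0) + 1))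
      atTop (𝓝 x) := by
  have h : Tendsto (fun n : ℕ => 1 / ((n : ℝ≥0) + 1)) atTop (𝓝 0) :=
    tendsto_one_div_add_atTop_nhds_zero_nat
  simpa [add_div] using (tendsto_floor_grid x).add h

theorem floor_grid_le (n : ℕ) (x : ℝ≥0) :
    (⌊((n : ℝ≥0) + 1) * x⌋₊ : ℝ≥0) / ((n : ℝ≥0) + 1) ≤ x := by
  rw [div_le_iff₀ (by positivity), mul_comm x]
  exact Nat.floor_le zero_le

theorem le_floor_add_one_grid (n : ℕ) (x : ℝ≥0) :
    x ≤ ((⌊((n : ℝ≥0) + 1) * x⌋₊ + 1 : ℕ) : ℝ≥0) / ((n : ℝ≥0) + 1) := by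
  rw [le_div_iff₀ (by positivity), mul_comm x]
  push_cast
  exact (Nat.lt_floor_add_one _).le

theorem measurable_floor_grid {Ω : Type*} {m : MeasurableSpace Ω} {θ : Ω → ℝ≥0}
    (hθ : Measurable θ) (n : ℕ) : Measurable fun ω => ⌊((n : ℝ≥0) + 1) * θ ω⌋₊ :=
  Nat.measurable_floor.comp (hθ.const_mul _)

section RandomTime

variable {Ω : Type*} {m : MeasurableSpace Ω} {f : ℝ≥0 → Ω → ℝ} {θ : Ω → ℝ≥0} {t : ℝ≥0∞}
  (hθ : Measurable θ) (hθt : ∀ ω, (θ ω : ℝ≥0∞) ≤ t)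
  (hf : ∀ s : ℝ≥0, (s : ℝ≥0∞) ≤ t → Measurable (f s))

include hθ hθt hf

theorem measurable_eval_of_leftContinuous
    (hc : ∀ ω s, ContinuousWithinAt (fun s => f s ω) (Iic s) s) :
    Measurable fun ω => f (θ ω) ω := by
  refine measurable_of_tendsto_metrizable (fun n =>
    measurable_eval_countable hf (fun k => (k : ℝ≥0) / ((n : ℝ≥0) + 1))
      (measurable_floor_grid hθ n)) (tendsto_pi_nhds.2 fun ω => ?_)
  refine (hc ω (θ ω)).tendsto.comp (tendsto_nhdsWithin_iff.2
    ⟨(tendsto_floor_grid (θ ω)).congr fun n => ?_, Eventually.of_forall fun n => ?_⟩)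
  · exact (stopTime_of_le ((ENNReal.coe_le_coe.2 (floor_grid_le n _)).trans (hθt ω))).symm
  · exact (stopTime_le _ _).trans (floor_grid_le n _)

/-- The grid approximates `θ` from above and is cut off at `t`. Since `θ ≤ t`, the cut-off points
remain above `θ`, and no information from after `t` is used. -/
theorem measurable_eval_of_rightContinuous
    (hc : ∀ ω s, ContinuousWithinAt (fun s => f s ω) (Ici s) s) :
    Measurable fun ω => f (θ ω) ω := by
  refine measurable_of_tendsto_metrizable (fun n =>
    measurable_eval_countable hf (fun k => ((k + 1 : ℕ) : ℝ≥0) / ((n : ℝ≥0) + 1))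
      (measurable_floor_grid hθ n)) (tendsto_pi_nhds.2 fun ω => ?_)
  refine (hc ω (θ ω)).tendsto.comp (tendsto_nhdsWithin_iff.2
    ⟨?_, Eventually.of_forall fun n => le_stopTime (le_floor_add_one_grid n _) (hθt ω)⟩)
  have h := ((continuous_stopTime t).tendsto (θ ω)).comp (tendsto_floor_add_one_grid (θ ω))
  rwa [stopTime_of_le (hθt ω)] at h

end RandomTime

/-! ### Running maxima -/

/-- The running maximum `sup_{s ≤ t} (Z_s - k_s)⁺`. -/
noncomputable def runMax (Z k : ℝ≥0 → ℝ) (t : ℝ≥0) : ℝ :=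
  sSup ((fun s => max 0 (Z s - k s)) '' Iic t)

section RunMax

variable {Z k : ℝ≥0 → ℝ} (hZ : Monotone Z) (hk : Monotone k)

theorem runMax_le {t : ℝ≥0} {a : ℝ} (ha : 0 ≤ a) (h : ∀ s ≤ t, Z s - k s ≤ a) :
    runMax Z k t ≤ a := by
  refine csSup_le (nonempty_Iic.image _) ?_
  rintro _ ⟨s, hs, rfl⟩
  exact max_le ha (h s hs)

include hZ hk

theorem bddAbove_runMax (t : ℝ≥0) : BddAbove ((fun s => max 0 (Z s - k s)) '' Iic t) := by
  refine ⟨max 0 (Z t - k 0), ?_⟩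
  rintro _ ⟨s, hs, rfl⟩
  exact max_le_max le_rfl (sub_le_sub (hZ hs) (hk zero_le))

theorem max_le_runMax {s t : ℝ≥0} (h : s ≤ t) : max 0 (Z s - k s) ≤ runMax Z k t :=
  le_csSup (bddAbove_runMax hZ hk t) (mem_image_of_mem _ h)

theorem le_runMax {s t : ℝ≥0} (h : s ≤ t) : Z s - k s ≤ runMax Z k t :=
  (le_max_right _ _).trans (max_le_runMax hZ hk h)

theorem runMax_nonneg (t : ℝ≥0) : 0 ≤ runMax Z k t :=
  (le_max_left _ _).trans (max_le_runMax hZ hk le_rfl)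

theorem monotone_runMax : Monotone (runMax Z k) := fun _ t h =>
  runMax_le (runMax_nonneg hZ hk t) fun _ hr => le_runMax hZ hk (hr.trans h)

/-- Just after $t$ the difference $Z-k$ can rise only through $Z$, because $k$ is non-decreasing;
right-continuity of $k$ is not needed. -/
theorem runMax_rightContinuous (hc : ∀ t, ContinuousWithinAt Z (Ici t) t) (t : ℝ≥0) :
    ContinuousWithinAt (runMax Z k) (Ici t) t := by
  refine tendsto_order.2 ⟨fun a ha => ?_, fun a ha => ?_⟩
  · filter_upwards [self_mem_nhdsWithin] with s hs using ha.trans_le (monotone_runMax hZ hk hs)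
  · obtain ⟨b, hb, hba⟩ := exists_between ha
    have h := (hc t).eventually_lt_const (lt_add_of_pos_right (Z t) (sub_pos.2 hb))
    filter_upwards [h, self_mem_nhdsWithin] with s hs hts
    refine lt_of_le_of_lt (runMax_le ((runMax_nonneg hZ hk t).trans hb.le) fun r hr => ?_) hba
    rcases le_total r t with hrt | hrt
    · exact (le_runMax hZ hk hrt).trans hb.le
    · have h1 := le_runMax hZ hk (le_refl t)
      have h2 := hZ hr
      have h3 := hk hrt
      linarith

/-- Reading $Z$ at the right end and $k$ at the left end of each cell makes every grid supremum an
upper bound. Conversely, monotonicity and one-sided continuity make $Z$ upper and $k$ lower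
semicontinuous, and a Lebesgue number makes this uniform on $[0,t]$, so the excess tends to zero. -/
theorem tendsto_grid_runMax (hcZ : ∀ t, ContinuousWithinAt Z (Ici t) t)
    (hck : ∀ t, ContinuousWithinAt k (Iic t) t) (t : ℝ≥0) :
    Tendsto (fun n : ℕ => ⨆ i : ℕ, max 0 (Z (min t (((i + 1 : ℕ) : ℝ≥0) / ((n : ℝ≥0) + 1))) -
      k (min t ((i : ℝ≥0) / ((n : ℝ≥0) + 1))))) atTop (𝓝 (runMax Z k t)) := by
  refine tendsto_order.2 ⟨fun a ha => Eventually.of_forall fun n => ha.trans_le ?_,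
    fun a ha => ?_⟩
  · have hbdd : BddAbove (range fun i : ℕ =>
        max 0 (Z (min t (((i + 1 : ℕ) : ℝ≥0) / ((n : ℝ≥0) + 1))) -
          k (min t ((i : ℝ≥0) / ((n : ℝ≥0) + 1))))) := by
      refine ⟨max 0 (Z t - k 0), ?_⟩
      rintro _ ⟨i, rfl⟩
      exact max_le_max le_rfl (sub_le_sub (hZ (min_le_left _ _)) (hk zero_le))
    refine csSup_le (nonempty_Iic.image _) ?_
    rintro _ ⟨s, hs, rfl⟩
    refine le_trans (max_le_max le_rfl (sub_le_sub (hZ ?_) (hk ?_)))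
      (le_ciSup hbdd ⌊((n : ℝ≥0) + 1) * s⌋₊)
    · exact le_min hs (le_floor_add_one_grid n s)
    · exact (min_le_right _ _).trans (floor_grid_le n s)
  · obtain ⟨b, hb, hba⟩ := exists_between ha
    have hb2 : 0 < (b - runMax Z k t) / 2 := by linarith
    have hU : ∀ s : ℝ≥0, ∃ U : Set ℝ≥0, IsOpen U ∧ s ∈ U ∧
        ∀ r ∈ U, Z r < Z s + (b - runMax Z k t) / 2 ∧ k s - (b - runMax Z k t) / 2 < k r := by
      intro s
      have h1 : ∀ᶠ r in 𝓝 s, Z r < Z s + (b - runMax Z k t) / 2 := by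
        rw [← nhdsLE_sup_nhdsGE]
        refine eventually_sup.2 ⟨?_, (hcZ s).eventually_lt_const (by linarith)⟩
        filter_upwards [self_mem_nhdsWithin] with r hr
        have := hZ hr
        linarith
      have h2 : ∀ᶠ r in 𝓝 s, k s - (b - runMax Z k t) / 2 < k r := by
        rw [← nhdsLE_sup_nhdsGE]
        refine eventually_sup.2 ⟨(hck s).eventually_const_lt (by linarith), ?_⟩
        filter_upwards [self_mem_nhdsWithin] with r hr
        have := hk hr
        linarith
      obtain ⟨U, hU, hUo, hsU⟩ := eventually_nhds_iff.1 (h1.and h2)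
      exact ⟨U, hUo, hsU, hU⟩
    choose U hUo hsU hU using hU
    obtain ⟨δ, hδ, hball⟩ := lebesgue_number_lemma_of_metric (isCompact_Icc (a := 0) (b := t))
      (c := fun s : Icc 0 t => U s) (fun s => hUo s)
      (fun s hs => mem_iUnion.2 ⟨⟨s, hs⟩, hsU s⟩)
    have hsmall : ∀ᶠ n : ℕ in atTop, 1 / ((n : ℝ) + 1) < δ :=
      tendsto_one_div_add_atTop_nhds_zero_nat.eventually_lt_const hδ
    filter_upwards [hsmall] with n hn
    refine lt_of_le_of_lt (ciSup_le fun i => ?_) hba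
    refine max_le ((runMax_nonneg hZ hk t).trans hb.le) ?_
    set r := min t ((i : ℝ≥0) / ((n : ℝ≥0) + 1)) with hr
    set q := min t (((i + 1 : ℕ) : ℝ≥0) / ((n : ℝ≥0) + 1)) with hq
    obtain ⟨s, hs⟩ := hball r ⟨zero_le, min_le_left _ _⟩
    have hqr : q ∈ Metric.ball r δ := by
      have h1 : r ≤ q := min_le_min le_rfl (by gcongr; simp)
      have h2 : q ≤ r + 1 / ((n : ℝ≥0) + 1) := by
        rw [hr, ← min_add_add_right]
        refine min_le_min (by simp) ?_
        rw [← add_div]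
        push_cast
        exact le_rfl
      have h1' : (r : ℝ) ≤ q := h1
      have h2' : (q : ℝ) ≤ r + 1 / ((n : ℝ) + 1) := by exact_mod_cast h2
      rw [Metric.mem_ball, NNReal.dist_eq, abs_of_nonneg (by linarith)]
      linarith
    have h1 := (hU s q (hs hqr)).1
    have h2 := (hU s r (hs (Metric.mem_ball_self hδ))).2
    have h3 := le_runMax hZ hk s.2.2
    linarith

end RunMax

theorem measurable_runMax {Ω : Type*} {m : MeasurableSpace Ω} {Z k : ℝ≥0 → Ω → ℝ} {t : ℝ≥0}
    (hmZ : ∀ s ≤ t, Measurable (Z s)) (hmk : ∀ s ≤ t, Measurable (k s))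
    (hZ : ∀ ω, Monotone fun s => Z s ω) (hk : ∀ ω, Monotone fun s => k s ω)
    (hcZ : ∀ ω t, ContinuousWithinAt (fun s => Z s ω) (Ici t) t)
    (hck : ∀ ω t, ContinuousWithinAt (fun s => k s ω) (Iic t) t) :
    Measurable fun ω => runMax (fun s => Z s ω) (fun s => k s ω) t := by
  refine measurable_of_tendsto_metrizable (fun n => ?_) (tendsto_pi_nhds.2 fun ω =>
    tendsto_grid_runMax (hZ ω) (hk ω) (hcZ ω) (hck ω) t)
  exact Measurable.iSup fun i => measurable_const.max
    ((hmZ _ (min_le_left _ _)).sub (hmk _ (min_le_left _ _)))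

/-! ### Deferring injections along a path -/

/-- Dividends `Z` when, up to time `σ`, only the excess of `Z` over the deferred injections `k`
is paid. -/
noncomputable def deferredZ (Z k : ℝ≥0 → ℝ) (σ : ℝ≥0∞) (t : ℝ≥0) : ℝ :=
  Z t - Z (stopTime σ t) + runMax Z k (stopTime σ t)

/-- Injections `K` when, up to time `σ`, the amount `k` is deferred, and immediately after `σ` the
part of it that has not been compensated by unpaid dividends is injected. -/
noncomputable def deferredK (Z K k : ℝ≥0 → ℝ) (κ : ℝ) (σ : ℝ≥0∞) (t : ℝ≥0) : ℝ :=
  if (t : ℝ≥0∞) ≤ σ then K t + κ - k t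
  else K t + κ - (Z (stopTime σ t) - runMax Z k (stopTime σ t))

theorem stopTime_eq_stopTime {σ : ℝ≥0∞} {s t : ℝ≥0} (hs : σ ≤ s) (ht : σ ≤ t) :
    stopTime σ s = stopTime σ t := by
  rw [← ENNReal.coe_inj, coe_stopTime_of_ge hs, coe_stopTime_of_ge ht]

theorem prelimit_eq_leftLim {g₀ : ℝ} {g : ℝ≥0 → ℝ} {t : ℝ≥0} (ht : t ≠ 0) :
    prelimit g₀ g t = Function.leftLim g t := if_neg ht

theorem Monotone.tendsto_prelimit {g : ℝ≥0 → ℝ} (hg : Monotone g) {t : ℝ≥0} (ht : t ≠ 0)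
    (g₀ : ℝ) : Tendsto g (𝓝[<] t) (𝓝 (prelimit g₀ g t)) := by
  rw [prelimit_eq_leftLim ht]
  exact hg.tendsto_leftLim t

section Deferred

variable {Z K k : ℝ≥0 → ℝ} {κ : ℝ} {σ : ℝ≥0∞}

theorem deferredZ_of_le {t : ℝ≥0} (h : (t : ℝ≥0∞) ≤ σ) : deferredZ Z k σ t = runMax Z k t := by
  rw [deferredZ, stopTime_of_le h]
  ring

theorem deferredK_of_le {t : ℝ≥0} (h : (t : ℝ≥0∞) ≤ σ) :
    deferredK Z K k κ σ t = K t + κ - k t := if_pos h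

theorem deferredK_of_lt {t : ℝ≥0} (h : σ < (t : ℝ≥0∞)) :
    deferredK Z K k κ σ t = K t + κ - (Z (stopTime σ t) - runMax Z k (stopTime σ t)) :=
  if_neg (not_le.2 h)

variable (hZ : Monotone Z) (hk : Monotone k)
include hZ hk

theorem monotone_deferredZ : Monotone (deferredZ Z k σ) := by
  intro s t hst
  unfold deferredZ
  have h1 := monotone_runMax hZ hk (stopTime_mono σ hst)
  rcases le_total (t : ℝ≥0∞) σ with ht | ht
  · rw [stopTime_of_le ht] at *
    rw [stopTime_of_le ((ENNReal.coe_le_coe.2 hst).trans ht)] at *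
    linarith
  · rcases le_total (s : ℝ≥0∞) σ with hs | hs
    · rw [stopTime_of_le hs] at *
      have := hZ (stopTime_le σ t)
      linarith
    · rw [stopTime_eq_stopTime hs ht]
      linarith [hZ hst]

theorem deferredZ_rightContinuous (hc : ∀ t, ContinuousWithinAt Z (Ici t) t) (t : ℝ≥0) :
    ContinuousWithinAt (deferredZ Z k σ) (Ici t) t :=
  ((hc t).sub (hc _).comp_stopTime_right).add
    (runMax_rightContinuous hZ hk hc _).comp_stopTime_right

theorem deferredZ_nonneg_zero : 0 ≤ deferredZ Z k σ 0 := by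
  rw [deferredZ_of_le (by simp)]
  exact runMax_nonneg hZ hk 0

/-- Across $\sigma$ the catch-up injection is $k_\sigma-(Z_\sigma-M_\sigma)$, with $M$ the running
maximum, and it is nonnegative because $M_\sigma\ge Z_\sigma-k_\sigma$. -/
theorem monotone_deferredK (hK : Monotone K) (hKk : Monotone fun t => K t - k t) :
    Monotone (deferredK Z K k κ σ) := by
  intro s t hst
  have h1 := hKk hst
  simp only at h1
  rcases le_or_gt (t : ℝ≥0∞) σ with ht | ht
  · rw [deferredK_of_le ht, deferredK_of_le ((ENNReal.coe_le_coe.2 hst).trans ht)]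
    linarith
  · rw [deferredK_of_lt ht]
    rcases le_or_gt (s : ℝ≥0∞) σ with hs | hs
    · rw [deferredK_of_le hs]
      have h2 := le_runMax hZ hk (le_refl (stopTime σ t))
      have h3 := hKk (le_stopTime hst hs)
      have h4 := hK (stopTime_le σ t)
      simp only at h3
      linarith
    · rw [deferredK_of_lt hs, stopTime_eq_stopTime hs.le ht.le]
      linarith [hK hst]

omit hZ hk in
theorem deferredK_leftContinuous (hcK : ∀ t, ContinuousWithinAt K (Iic t) t)
    (hck : ∀ t, ContinuousWithinAt k (Iic t) t) (t : ℝ≥0) :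
    ContinuousWithinAt (deferredK Z K k κ σ) (Iic t) t := by
  rcases le_or_gt (t : ℝ≥0∞) σ with ht | ht
  · refine (((hcK t).add continuousWithinAt_const).sub (hck t)).congr (fun s hs => ?_)
      (deferredK_of_le ht)
    exact deferredK_of_le ((ENNReal.coe_le_coe.2 hs).trans ht)
  · have h : ContinuousWithinAt
        (fun s => K s + κ - (Z (stopTime σ t) - runMax Z k (stopTime σ t))) (Iic t) t :=
      ((hcK t).add continuousWithinAt_const).sub continuousWithinAt_const
    refine h.congr_of_eventuallyEq ?_ (deferredK_of_lt ht)
    have : ∀ᶠ s : ℝ≥0 in 𝓝[≤] t, σ < s := mem_nhdsWithin_of_mem_nhds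
      ((isOpen_lt continuous_const ENNReal.continuous_coe).mem_nhds ht)
    filter_upwards [this] with s hs
    rw [deferredK_of_lt hs, stopTime_eq_stopTime hs.le ht.le]

/-- Lump-sum dividends that are covered by the reserve remain so when injections are deferred. -/
theorem deferredZ_le_max {R : ℝ≥0 → ℝ} (hk0 : k 0 = κ) (hκ : 0 ≤ κ)
    (h : ∀ t, Z t ≤ max (prelimit 0 Z t) (κ + R t + K t)) (t : ℝ≥0) :
    deferredZ Z k σ t ≤
      max (prelimit 0 (deferredZ Z k σ) t) (R t + deferredK Z K k κ σ t) := by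
  have hm := monotone_deferredZ (σ := σ) hZ hk
  rcases le_or_gt (t : ℝ≥0∞) σ with ht | ht
  · rw [deferredK_of_le ht, deferredZ_of_le ht]
    set L := prelimit 0 (deferredZ Z k σ) t with hL
    have hLn : 0 ≤ L ∧ prelimit 0 Z t - k t ≤ L ∧ ∀ s < t, runMax Z k s ≤ L := by
      by_cases ht0 : t = 0
      · subst ht0
        rw [hL, prelimit_zero, prelimit_zero, hk0]
        exact ⟨le_rfl, by linarith, fun s hs => absurd hs not_lt_zero⟩
      · have := neBot_nhdsLT ht0
        have h3 : ∀ s < t, runMax Z k s ≤ L := fun s hs => by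
          rw [← deferredZ_of_le (Z := Z) (k := k)
            ((ENNReal.coe_le_coe.2 (le_of_lt hs)).trans ht), hL, prelimit_eq_leftLim ht0]
          exact hm.le_leftLim hs
        refine ⟨(runMax_nonneg hZ hk 0).trans (h3 0 (pos_iff_ne_zero.2 ht0)), ?_, h3⟩
        refine le_of_tendsto ((hZ.tendsto_prelimit ht0 0).sub_const (k t)) ?_
        filter_upwards [self_mem_nhdsWithin] with s hs
        have h4 := le_runMax hZ hk (le_refl s)
        have h5 := h3 s hs
        have h6 := hk (le_of_lt hs)
        linarith
    obtain ⟨hL0, hL1, hL2⟩ := hLn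
    refine runMax_le (hL0.trans (le_max_left _ _)) fun s hs => ?_
    -- Only $s=t$ can push the maximum above its left limit. There, either $Z$ does not jump and
    -- $Z_t-k_t\le L$, or the original bound on $Z_t$, lowered by $k_t$, is the required one.
    rcases hs.eq_or_lt with rfl | hs
    · rcases le_max_iff.1 (h s) with h | h
      · exact le_max_of_le_left (by linarith)
      · exact le_max_of_le_right (by linarith)
    · exact le_max_of_le_left ((le_runMax hZ hk le_rfl).trans (hL2 s hs))
  · have ht0 : t ≠ 0 := by
      rintro rfl
      simp at ht
    have hpre : prelimit 0 (deferredZ Z k σ) t =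
        prelimit 0 Z t - Z (stopTime σ t) + runMax Z k (stopTime σ t) := by
      refine prelimit_eq_of_tendsto ht0
        ((((hZ.tendsto_prelimit ht0 0).sub_const _).add_const _).congr' ?_)
      have : ∀ᶠ s : ℝ≥0 in 𝓝[<] t, σ < s := mem_nhdsWithin_of_mem_nhds
        ((isOpen_lt continuous_const ENNReal.continuous_coe).mem_nhds ht)
      filter_upwards [this] with s hs
      rw [deferredZ, stopTime_eq_stopTime hs.le ht.le]
    rw [hpre, deferredK_of_lt ht, deferredZ]
    rcases le_max_iff.1 (h t) with h | h
    · exact le_max_of_le_left (by linarith)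
    · exact le_max_of_le_right (by linarith)

omit hk in
theorem deferredZ_le (hZ0 : 0 ≤ Z 0) (hk0 : ∀ t, 0 ≤ k t) (t : ℝ≥0) : deferredZ Z k σ t ≤ Z t := by
  have : runMax Z k (stopTime σ t) ≤ Z (stopTime σ t) :=
    runMax_le (hZ0.trans (hZ zero_le)) fun s hs => by linarith [hZ hs, hk0 s]
  unfold deferredZ
  linarith

omit hk in
theorem deferredK_le (hZ0 : 0 ≤ Z 0) (hk0 : ∀ t, 0 ≤ k t) (t : ℝ≥0) :
    deferredK Z K k κ σ t ≤ K t + κ := by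
  have : runMax Z k (stopTime σ t) ≤ Z (stopTime σ t) :=
    runMax_le (hZ0.trans (hZ zero_le)) fun s hs => by linarith [hZ hs, hk0 s]
  unfold deferredK
  split_ifs
  · linarith [hk0 t]
  · linarith

/-- The gain from deferring injections that cost `δ > 1` per unit. -/
theorem add_le_deferred {δ : ℝ} (hδ : 1 ≤ δ) (hZ0 : 0 ≤ Z 0) (hk0 : ∀ t, 0 ≤ k t) (t : ℝ≥0) :
    Z t + δ * deferredK Z K k κ σ t + (if (t : ℝ≥0∞) ≤ σ then (δ - 1) * k t else 0) ≤
      deferredZ Z k σ t + δ * K t + δ * κ := by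
  split_ifs with h
  · rw [deferredZ_of_le h, deferredK_of_le h]
    have := le_runMax hZ hk (le_refl t)
    nlinarith
  · rw [deferredK_of_lt (not_le.1 h), deferredZ]
    have : runMax Z k (stopTime σ t) ≤ Z (stopTime σ t) :=
      runMax_le (hZ0.trans (hZ zero_le)) fun s hs => by linarith [hZ hs, hk0 s]
    nlinarith

end Deferred

/-! ### Injections beyond the shortfall at a given time -/

/-- The amount `κ`, plus the injections made from time `τ` on, except for an amount `b_τ`. -/
noncomputable def excessInjection (K b : ℝ≥0 → ℝ) (κ : ℝ) (τ : ℝ≥0∞) (t : ℝ≥0) : ℝ :=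
  κ + max 0 (K t - K (stopTime τ t) - max 0 (b (stopTime τ t)))

section Excess

variable {K b : ℝ≥0 → ℝ} {κ : ℝ} {τ : ℝ≥0∞}

theorem excessInjection_of_le {t : ℝ≥0} (h : (t : ℝ≥0∞) ≤ τ) : excessInjection K b κ τ t = κ := by
  rw [excessInjection, stopTime_of_le h, max_eq_left, add_zero]
  linarith [le_max_left 0 (b t)]

theorem le_excessInjection (t : ℝ≥0) : κ ≤ excessInjection K b κ τ t := by
  unfold excessInjection
  linarith [le_max_left 0 (K t - K (stopTime τ t) - max 0 (b (stopTime τ t)))]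

theorem monotone_excessInjection (hK : Monotone K) : Monotone (excessInjection K b κ τ) := by
  intro s t hst
  rcases le_total (s : ℝ≥0∞) τ with hs | hs
  · rw [excessInjection_of_le hs]
    exact le_excessInjection t
  · rw [excessInjection, excessInjection,
      stopTime_eq_stopTime hs (hs.trans (ENNReal.coe_le_coe.2 hst))]
    have := hK hst
    gcongr

/-- After $\tau$ the injections are split by order: the first $b_\tau^+$ units are kept and the rest
is excess, so both parts grow. This makes the deferred injection process non-decreasing. -/
theorem monotone_sub_excessInjection (hK : Monotone K) :
    Monotone fun t => K t - excessInjection K b κ τ t := by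
  intro s t hst
  have h1 := hK hst
  rcases le_total (s : ℝ≥0∞) τ with hs | hs
  · simp only [excessInjection_of_le hs]
    have h2 := hK (le_stopTime hst hs)
    have h3 := le_max_left 0 (b (stopTime τ t))
    unfold excessInjection
    rcases max_cases 0 (K t - K (stopTime τ t) - max 0 (b (stopTime τ t))) with h | h <;> linarith
  · simp only [excessInjection,
      stopTime_eq_stopTime hs (hs.trans (ENNReal.coe_le_coe.2 hst))]
    rcases max_cases 0 (K t - K (stopTime τ t) - max 0 (b (stopTime τ t))) with h | h <;>
    rcases max_cases 0 (K s - K (stopTime τ t) - max 0 (b (stopTime τ t))) with h' | h' <;>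
    linarith

theorem excessInjection_leftContinuous (hc : ∀ t, ContinuousWithinAt K (Iic t) t) (t : ℝ≥0) :
    ContinuousWithinAt (excessInjection K b κ τ) (Iic t) t := by
  rcases le_or_gt (t : ℝ≥0∞) τ with ht | ht
  · exact continuousWithinAt_const.congr (fun s hs => excessInjection_of_le
      ((ENNReal.coe_le_coe.2 hs).trans ht)) (excessInjection_of_le ht)
  · have h : ContinuousWithinAt
        (fun s => κ + max 0 (K s - K (stopTime τ t) - max 0 (b (stopTime τ t)))) (Iic t) t := by
      have := hc t
      exact continuousWithinAt_const.add (continuousWithinAt_const.max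
        ((this.sub continuousWithinAt_const).sub continuousWithinAt_const))
    refine h.congr_of_eventuallyEq ?_ rfl
    have : ∀ᶠ s : ℝ≥0 in 𝓝[≤] t, τ < s := mem_nhdsWithin_of_mem_nhds
      ((isOpen_lt continuous_const ENNReal.continuous_coe).mem_nhds ht)
    filter_upwards [this] with s hs
    rw [excessInjection, stopTime_eq_stopTime hs.le ht.le]

end Excess

/-- The right limit at $s$ is a limit of values at times in $(s,t]$, hence is known at any later
time `t`. -/
theorem measurable_rightLim {Ω : Type*} {m : MeasurableSpace Ω} {K : ℝ≥0 → Ω → ℝ}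
    (hK : ∀ ω, Monotone fun s => K s ω) {s t : ℝ≥0} (hst : s < t)
    (hm : ∀ r ≤ t, Measurable (K r)) :
    Measurable fun ω => Function.rightLim (fun r => K r ω) s := by
  refine measurable_of_tendsto_metrizable
    (f := fun n : ℕ => K (min t (s + 1 / ((n : ℝ≥0) + 1))))
    (fun n => hm _ (min_le_left _ _)) (tendsto_pi_nhds.2 fun ω => ?_)
  refine ((hK ω).tendsto_rightLim s).comp (tendsto_nhdsWithin_iff.2
    ⟨?_, Eventually.of_forall fun n => lt_min hst (lt_add_of_pos_right _ (by positivity))⟩)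
  have h1 : Tendsto (fun n : ℕ => s + 1 / ((n : ℝ≥0) + 1)) atTop (𝓝 (s + 0)) :=
    tendsto_const_nhds.add tendsto_one_div_add_atTop_nhds_zero_nat
  have h2 := (tendsto_const_nhds (x := t)).min h1
  rwa [add_zero, min_eq_right hst.le] at h2

namespace HawkesClaims

variable {p : RiskParams} {y : ℝ} {Ω : Type*} [m : MeasurableSpace Ω] {P : Measure Ω}
  {𝔽 : Filtration ℝ≥0 m} (M : HawkesClaims p y P 𝔽)

/-! ### The uncontrolled reserve -/

/-- The aggregate claims up to time `t`. -/
noncomputable def claims (t : ℝ≥0) (ω : Ω) : ℝ := ∑ k ∈ Finset.range (M.N t ω), M.Y k ω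

theorem reserve_eq (x : ℝ) (t : ℝ≥0) (ω : Ω) : M.reserve x t ω = x + p.c * t - M.claims t ω := rfl

theorem monotone_claims (ω : Ω) : Monotone fun t => M.claims t ω := fun _ _ h =>
  Finset.sum_le_sum_of_subset_of_nonneg (Finset.range_mono (M.N_mono ω h))
    fun k _ _ => (M.Y_pos k ω).le

theorem claims_nonneg (t : ℝ≥0) (ω : Ω) : 0 ≤ M.claims t ω :=
  Finset.sum_nonneg fun k _ => (M.Y_pos k ω).le

theorem eventually_N_eq (ω : Ω) (t : ℝ≥0) : ∀ᶠ s in 𝓝[≥] t, M.N s ω = M.N t ω :=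
  (M.N_rightContinuous ω t).eventually_mem (by simp : {M.N t ω} ∈ 𝓝 (M.N t ω))

theorem claims_rightContinuous (ω : Ω) (t : ℝ≥0) :
    ContinuousWithinAt (fun s => M.claims s ω) (Ici t) t := by
  have h : ContinuousWithinAt (fun _ => M.claims t ω) (Ici t) t := continuousWithinAt_const
  refine h.congr_of_eventuallyEq ?_ rfl
  filter_upwards [M.eventually_N_eq ω t] with s hs
  rw [claims, claims, hs]

theorem reserve_rightContinuous (x : ℝ) (ω : Ω) (t : ℝ≥0) :
    ContinuousWithinAt (fun s => M.reserve x s ω) (Ici t) t :=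
  ((continuous_const.add (continuous_const.mul NNReal.continuous_coe)).continuousWithinAt).sub
    (M.claims_rightContinuous ω t)

theorem measurable_reserve (x : ℝ) (t : ℝ≥0) : Measurable[𝔽 t] (M.reserve x t) :=
  (measurable_const (a := x + p.c * t)).sub (M.claims_adapted t)

theorem reserve_le (x : ℝ) (t : ℝ≥0) (ω : Ω) : M.reserve x t ω ≤ x + p.c * t := by
  rw [reserve_eq]
  linarith [M.claims_nonneg t ω]

theorem reserve_le_reserve (x : ℝ) {s t : ℝ≥0} {ω : Ω} (hst : s ≤ t) (h : M.N s ω = M.N t ω) :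
    M.reserve x s ω ≤ M.reserve x t ω := by
  rw [reserve_eq, reserve_eq, claims, claims, h]
  have h1 : (s : ℝ) ≤ t := hst
  have h2 := mul_le_mul_of_nonneg_left h1 p.c_pos.le
  linarith

theorem reserve_add (x κ : ℝ) (t : ℝ≥0) (ω : Ω) :
    M.reserve (x + κ) t ω = κ + M.reserve x t ω := by
  rw [reserve_eq, reserve_eq]
  ring

/-! ### Claim times -/

/-- The time of the `n`-th claim. -/
noncomputable def claimTime (n : ℕ) (ω : Ω) : ℝ≥0∞ := sInf {s | ∃ t : ℝ≥0, s = t ∧ n ≤ M.N t ω}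

/-- Right-continuity of the integer-valued path makes it constant just after `t`, so the infimum is
attained. -/
theorem claimTime_le_iff {n : ℕ} {ω : Ω} {t : ℝ≥0} : M.claimTime n ω ≤ t ↔ n ≤ M.N t ω := by
  refine ⟨fun h => ?_, fun h => sInf_le ⟨t, rfl, h⟩⟩
  obtain ⟨s, hs, hts⟩ := (((M.eventually_N_eq ω t).filter_mono
    (nhdsWithin_mono t Ioi_subset_Ici_self)).and self_mem_nhdsWithin).exists
  have h1 : M.claimTime n ω < s := h.trans_lt (ENNReal.coe_lt_coe.2 hts)
  obtain ⟨_, ⟨r, rfl, hr⟩, hrs⟩ := sInf_lt_iff.1 h1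
  rw [← hs]
  exact hr.trans (M.N_mono ω (ENNReal.coe_lt_coe.1 hrs).le)

theorem lt_claimTime_iff {n : ℕ} {ω : Ω} {t : ℝ≥0} : (t : ℝ≥0∞) < M.claimTime n ω ↔ M.N t ω < n := by
  rw [← not_le, claimTime_le_iff, not_le]

theorem claimTime_zero (ω : Ω) : M.claimTime 0 ω = 0 :=
  le_antisymm (M.claimTime_le_iff (t := 0).2 (Nat.zero_le _)) bot_le

theorem claimTime_one_pos (ω : Ω) : 0 < M.claimTime 1 ω :=
  M.lt_claimTime_iff (t := 0).2 (by rw [M.N_zero]; exact one_pos)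

theorem measurable_stopTime_claimTime (n : ℕ) (t : ℝ≥0) :
    Measurable[𝔽 t] fun ω => stopTime (M.claimTime n ω) t := by
  refine measurable_of_Iic fun r => ?_
  rcases le_or_gt t r with h | h
  · convert! MeasurableSet.univ
    exact eq_univ_of_forall fun ω => (stopTime_le _ _).trans h
  · have : (fun ω => stopTime (M.claimTime n ω) t) ⁻¹' Iic r = M.N r ⁻¹' Ici n := by
      ext ω
      rw [mem_preimage, mem_preimage, mem_Ici, mem_Iic, ← claimTime_le_iff, ← ENNReal.coe_le_coe,
        coe_stopTime, min_le_iff, or_iff_right]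
      exact not_le.2 (ENNReal.coe_lt_coe.2 h)
    rw [this]
    exact 𝔽.mono h.le _ (M.N_adapted r measurableSet_Ici)

/-! ### The controlled surplus -/

variable {x : ℝ} {α : Strategy Ω} {ω : Ω}

theorem tendsto_surplus_right (x : ℝ) (α : Strategy Ω) (t : ℝ≥0) (ω : Ω) :
    Tendsto (fun s => M.surplus x α s ω) (𝓝[>] t)
      (𝓝 (M.reserve x t ω - α.Z t ω + Function.rightLim (fun s => α.K s ω) t)) :=
  ((((M.reserve_rightContinuous x ω t).mono Ioi_subset_Ici_self).sub
    ((α.Z_rightContinuous ω t).mono Ioi_subset_Ici_self)).tendsto).add ((α.K_mono ω).tendsto_rightLim t)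

theorem surplusAfter_eq (x : ℝ) (α : Strategy Ω) (t : ℝ≥0) (ω : Ω) :
    M.surplusAfter x α t ω =
      M.reserve x t ω - α.Z t ω + Function.rightLim (fun s => α.K s ω) t :=
  rightLim_eq_of_tendsto (M.tendsto_surplus_right x α t ω)

theorem prelimit_reserve (t : ℝ≥0) (ω : Ω) : prelimit 0 (fun s => M.reserve 0 s ω) t =
    p.c * t - prelimit 0 (fun s => M.claims s ω) t := by
  by_cases ht : t = 0
  · simp [ht, prelimit_zero]
  · refine prelimit_eq_of_tendsto ht (Tendsto.sub ?_ ((M.monotone_claims ω).tendsto_prelimit ht 0))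
    have : Continuous fun s : ℝ≥0 => (0 : ℝ) + p.c * s := by fun_prop
    simpa using (this.tendsto t).mono_left (nhdsWithin_le_nhds (s := Iio t))

theorem prelimit_surplus (x : ℝ) (α : Strategy Ω) (t : ℝ≥0) (ω : Ω) :
    prelimit x (fun s => M.surplus x α s ω) t =
      x + p.c * t - prelimit 0 (fun s => M.claims s ω) t - prelimit 0 (fun s => α.Z s ω) t
        + α.K t ω := by
  by_cases ht : t = 0
  · simp [ht, prelimit_zero, α.K_zero]
  · refine prelimit_eq_of_tendsto ht (Tendsto.add (Tendsto.sub (Tendsto.sub ?_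
      ((M.monotone_claims ω).tendsto_prelimit ht 0)) ((α.Z_mono ω).tendsto_prelimit ht 0))
      ((α.K_leftContinuous ω t).mono Iio_subset_Iic_self))
    have : Continuous fun s : ℝ≥0 => x + p.c * s := by fun_prop
    exact (this.tendsto t).mono_left nhdsWithin_le_nhds

/-- Since $X_{t-}+R^0_t-R^0_{t-}=R^x_t+K_t-Z_{t-}$, also at $t=0$, the jump condition becomes a
bound on $Z_t$ in which the only left limit is that of $Z$. -/
theorem dividend_le_iff (x : ℝ) (α : Strategy Ω) (t : ℝ≥0) (ω : Ω) :
    α.Z t ω - prelimit 0 (fun s => α.Z s ω) t ≤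
        max 0 (prelimit x (fun s => M.surplus x α s ω) t
          + M.reserve 0 t ω - prelimit 0 (fun s => M.reserve 0 s ω) t) ↔
      α.Z t ω ≤ max (prelimit 0 (fun s => α.Z s ω) t) (M.reserve x t ω + α.K t ω) := by
  rw [prelimit_surplus, prelimit_reserve, sub_le_iff_le_add, ← max_add_add_right, reserve_eq,
    reserve_eq]
  ring_nf

theorem IsAdmissible.dividend_le_max (h : M.IsAdmissible x α) (ω : Ω) (t : ℝ≥0) :
    α.Z t ω ≤ max (prelimit 0 (fun s => α.Z s ω) t) (M.reserve x t ω + α.K t ω) :=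
  (M.dividend_le_iff x α t ω).1 (h.dividend_le ω t)

/-! ### The ruin time -/

theorem surplusAfter_nonneg {t : ℝ≥0} (h : (t : ℝ≥0∞) < M.ruinTime x α ω) :
    0 ≤ M.surplusAfter x α t ω := by
  by_contra! hneg
  exact h.not_ge (sInf_le ⟨t, rfl, hneg⟩)

theorem le_ruinTime {T : ℝ≥0∞}
    (h : ∀ t : ℝ≥0, (t : ℝ≥0∞) < T → 0 ≤ M.surplusAfter x α t ω) : T ≤ M.ruinTime x α ω := by
  refine le_sInf ?_
  rintro _ ⟨t, rfl, ht⟩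
  exact not_lt.1 fun hlt => (h t hlt).not_gt ht

theorem Z_le_of_lt_ruinTime {s t : ℝ≥0} (h : (s : ℝ≥0∞) < M.ruinTime x α ω) (hst : s < t) :
    α.Z s ω ≤ M.reserve x s ω + α.K t ω := by
  have h1 := M.surplusAfter_nonneg h
  rw [surplusAfter_eq] at h1
  have h2 := (α.K_mono ω).rightLim_le hst
  linarith

/-- Until ruin, the surplus is nonnegative whenever no claim has just arrived. -/
theorem surplus_nonneg (hα : M.IsAdmissible x α) {r t : ℝ≥0}
    (ht : (t : ℝ≥0∞) ≤ M.ruinTime x α ω) (hrt : r < t) (hN : M.N r ω = M.N t ω) :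
    0 ≤ M.surplus x α t ω := by
  have ht0 : t ≠ 0 := (zero_le.trans_lt hrt).ne'
  have := neBot_nhdsLT ht0
  -- No claim arrives just before or at `t`, so the reserve does not drop and the solvency bound on
  -- $Z_s$ passes to the left limit. The admissibility bound then extends it to $Z_t$.
  have h1 : prelimit 0 (fun s => α.Z s ω) t ≤ M.reserve x t ω + α.K t ω := by
    refine le_of_tendsto ((α.Z_mono ω).tendsto_prelimit ht0 0) ?_
    filter_upwards [Ioo_mem_nhdsLT hrt] with s hs
    have h2 := M.Z_le_of_lt_ruinTime ((ENNReal.coe_lt_coe.2 hs.2).trans_le ht) hs.2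
    have h3 : M.N s ω = M.N t ω :=
      le_antisymm (M.N_mono ω hs.2.le) (hN ▸ M.N_mono ω hs.1.le)
    linarith [M.reserve_le_reserve x hs.2.le h3]
  have h2 := hα.dividend_le_max M ω t
  rw [max_eq_right h1] at h2
  unfold surplus
  linarith

/-- Dividends up to ruin are financed by the initial reserve, premiums, and injections. -/
theorem Z_le_of_le_ruinTime (hα : M.IsAdmissible x α) {t : ℝ≥0}
    (ht : (t : ℝ≥0∞) ≤ M.ruinTime x α ω) : α.Z t ω ≤ max 0 x + p.c * t + α.K t ω := by
  have hc : 0 ≤ p.c * t := mul_nonneg p.c_pos.le t.2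
  have hK : 0 ≤ α.K t ω := (α.K_zero ω).ge.trans (α.K_mono ω zero_le)
  refine (hα.dividend_le_max M ω t).trans (max_le ?_ ?_)
  · by_cases ht0 : t = 0
    · rw [ht0, prelimit_zero, ← ht0]
      linarith [le_max_left 0 x]
    · have := neBot_nhdsLT ht0
      refine le_of_tendsto ((α.Z_mono ω).tendsto_prelimit ht0 0) ?_
      filter_upwards [self_mem_nhdsWithin] with s hs
      have h2 := M.Z_le_of_lt_ruinTime ((ENNReal.coe_lt_coe.2 hs).trans_le ht) hs
      have h3 := M.reserve_le x s ω
      have h4 : p.c * s ≤ p.c * t :=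
        mul_le_mul_of_nonneg_left (NNReal.coe_le_coe.2 (le_of_lt hs)) p.c_pos.le
      linarith [le_max_right 0 x]
  · linarith [M.reserve_le x t ω, le_max_right 0 x]

theorem exists_Ioo_surplusAfter_neg {t : ℝ≥0} (h : M.surplusAfter x α t ω < 0) :
    ∃ u > t, ∀ r ∈ Ioo t u, M.surplusAfter x α r ω < 0 := by
  obtain ⟨a, ha, ha0⟩ := exists_between h
  have h1 := M.tendsto_surplus_right x α t ω
  rw [← surplusAfter_eq] at h1
  obtain ⟨u, hu, hsub⟩ := mem_nhdsGT_iff_exists_Ioo_subset.1 (h1.eventually_lt_const ha)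
  refine ⟨u, hu, fun r hr => lt_of_le_of_lt ?_ ha0⟩
  have h2 := M.tendsto_surplus_right x α r ω
  rw [← surplusAfter_eq] at h2
  refine le_of_tendsto h2 ?_
  filter_upwards [Ioo_mem_nhdsGT hr.2] with s hs
  exact le_of_lt (hsub ⟨hr.1.trans hs.1, hs.2⟩)

/-- A negative right limit stays negative on an interval to the right, so countably many times
detect ruin strictly before `t`. -/
theorem ruinTime_lt_iff {t : ℝ≥0} : M.ruinTime x α ω < t ↔
    ∃ n, TopologicalSpace.denseSeq ℝ≥0 n < t ∧
      M.surplusAfter x α (TopologicalSpace.denseSeq ℝ≥0 n) ω < 0 := by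
  constructor
  · intro h
    obtain ⟨_, ⟨s, rfl, hs⟩, hst⟩ := sInf_lt_iff.1 h
    obtain ⟨u, hu, hneg⟩ := M.exists_Ioo_surplusAfter_neg hs
    obtain ⟨n, hn⟩ := (TopologicalSpace.denseRange_denseSeq ℝ≥0).exists_mem_open
      isOpen_Ioo (nonempty_Ioo.2 (lt_min hu (ENNReal.coe_lt_coe.1 hst)))
    exact ⟨n, hn.2.trans_le (min_le_right _ _), hneg _ ⟨hn.1, hn.2.trans_le (min_le_left _ _)⟩⟩
  · rintro ⟨n, hn, hneg⟩
    exact (sInf_le ⟨_, rfl, hneg⟩ : M.ruinTime x α ω ≤ _).trans_lt (ENNReal.coe_lt_coe.2 hn)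

theorem measurable_surplusAfter (hα : M.IsAdmissible x α) {s t : ℝ≥0} (hst : s < t) :
    Measurable[𝔽 t] (M.surplusAfter x α s) := by
  have h : M.surplusAfter x α s = fun ω =>
      M.reserve x s ω - α.Z s ω + Function.rightLim (fun r => α.K r ω) s :=
    funext fun ω => M.surplusAfter_eq x α s ω
  rw [h]
  refine (((M.measurable_reserve x s).mono (𝔽.mono hst.le) le_rfl).sub
    ((hα.Z_adapted s).mono (𝔽.mono hst.le) le_rfl)).add ?_
  exact measurable_rightLim α.K_mono hst fun r hr => (hα.K_adapted r).mono (𝔽.mono hr) le_rfl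

theorem measurableSet_ruinTime_lt (hα : M.IsAdmissible x α) (t : ℝ≥0) :
    MeasurableSet[𝔽 t] {ω | M.ruinTime x α ω < t} := by
  simp only [ruinTime_lt_iff, ofPred_exists]
  refine MeasurableSet.iUnion fun n => ?_
  by_cases h : TopologicalSpace.denseSeq ℝ≥0 n < t
  · simp only [h, true_and]
    exact M.measurable_surplusAfter hα h measurableSet_Iio
  · simp [h]

theorem measurable_ruinTime (hα : M.IsAdmissible x α) : Measurable (M.ruinTime x α) := by
  have h (t : ℝ≥0) : MeasurableSet {ω | M.ruinTime x α ω < t} :=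
    𝔽.le t _ (M.measurableSet_ruinTime_lt hα t)
  refine measurable_of_Iio fun r => ?_
  induction r with
  | coe t => exact h t
  | top =>
    have : M.ruinTime x α ⁻¹' Iio ⊤ = ⋃ n : ℕ, {ω | M.ruinTime x α ω < (n : ℝ≥0)} := by
      ext ω
      simp only [mem_preimage, mem_Iio, mem_iUnion, mem_ofPred_eq]
      refine ⟨fun hω => ?_, fun ⟨n, hn⟩ => hn.trans ENNReal.coe_lt_top⟩
      obtain ⟨n, hn⟩ := ENNReal.exists_nat_gt hω.ne
      exact ⟨n, by simpa using hn⟩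
    rw [this]
    exact MeasurableSet.iUnion fun n => h n

/-- For $r\le t$ the event $\{T\wedge t<r\}$ is $\{T<r\}$, so the strict events are enough. -/
theorem measurable_stopTime_ruinTime (hα : M.IsAdmissible x α) (t : ℝ≥0) :
    Measurable[𝔽 t] fun ω => stopTime (M.ruinTime x α ω) t := by
  refine measurable_of_Iio fun r => ?_
  rcases lt_or_ge t r with h | h
  · convert! MeasurableSet.univ
    exact eq_univ_of_forall fun ω => (stopTime_le _ _).trans_lt h
  · have : (fun ω => stopTime (M.ruinTime x α ω) t) ⁻¹' Iio r = {ω | M.ruinTime x α ω < r} := by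
      ext ω
      rw [mem_preimage, mem_Iio, mem_ofPred_eq, ← ENNReal.coe_lt_coe, coe_stopTime, min_lt_iff,
        or_iff_right]
      exact not_lt.2 (ENNReal.coe_le_coe.2 h)
    rw [this]
    exact 𝔽.mono h _ (M.measurableSet_ruinTime_lt hα r)

end HawkesClaims

/-! ### Stopping a strategy at a random time -/

namespace Strategy

variable {Ω : Type*}

theorem Z_nonneg (α : Strategy Ω) (t : ℝ≥0) (ω : Ω) : 0 ≤ α.Z t ω :=
  (α.Z_zero_nonneg ω).trans (α.Z_mono ω zero_le)

theorem K_nonneg (α : Strategy Ω) (t : ℝ≥0) (ω : Ω) : 0 ≤ α.K t ω :=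
  (α.K_zero ω).ge.trans (α.K_mono ω zero_le)

/-- The strategy that follows `α` until time `T`, and does nothing from then on; a lump-sum
injection of `α` at time `T` is not made. -/
noncomputable def stopped (α : Strategy Ω) (T : Ω → ℝ≥0∞) : Strategy Ω where
  Z t ω := α.Z (stopTime (T ω) t) ω
  K t ω := α.K (stopTime (T ω) t) ω
  Z_mono ω := (α.Z_mono ω).comp (stopTime_mono (T ω))
  Z_rightContinuous ω _ := (α.Z_rightContinuous ω _).comp_stopTime_right (g := fun s => α.Z s ω)
  Z_zero_nonneg ω := α.Z_nonneg _ ω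
  K_mono ω := (α.K_mono ω).comp (stopTime_mono (T ω))
  K_leftContinuous ω _ := (α.K_leftContinuous ω _).comp_stopTime_left (g := fun s => α.K s ω)
  K_zero ω := by rw [stopTime_zero, α.K_zero]

end Strategy

namespace HawkesClaims

variable {p : RiskParams} {y : ℝ} {Ω : Type*} [m : MeasurableSpace Ω] {P : Measure Ω}
  {𝔽 : Filtration ℝ≥0 m} (M : HawkesClaims p y P 𝔽) {x κ : ℝ} {α : Strategy Ω} {ω : Ω}

theorem measurable_eval_Z (hα : M.IsAdmissible x α) {θ : Ω → ℝ≥0} {t : ℝ≥0}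
    (hθ : Measurable[𝔽 t] θ) (hθt : ∀ ω, θ ω ≤ t) : Measurable[𝔽 t] fun ω => α.Z (θ ω) ω :=
  measurable_eval_of_rightContinuous (t := t) hθ (fun ω => ENNReal.coe_le_coe.2 (hθt ω))
    (fun s hs => (hα.Z_adapted s).mono (𝔽.mono (ENNReal.coe_le_coe.1 hs)) le_rfl)
    α.Z_rightContinuous

theorem measurable_eval_K (hα : M.IsAdmissible x α) {θ : Ω → ℝ≥0} {t : ℝ≥0}
    (hθ : Measurable[𝔽 t] θ) (hθt : ∀ ω, θ ω ≤ t) : Measurable[𝔽 t] fun ω => α.K (θ ω) ω :=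
  measurable_eval_of_leftContinuous (t := t) hθ (fun ω => ENNReal.coe_le_coe.2 (hθt ω))
    (fun s hs => (hα.K_adapted s).mono (𝔽.mono (ENNReal.coe_le_coe.1 hs)) le_rfl)
    α.K_leftContinuous

theorem measurable_eval_reserve (x : ℝ) {θ : Ω → ℝ≥0} {t : ℝ≥0}
    (hθ : Measurable[𝔽 t] θ) (hθt : ∀ ω, θ ω ≤ t) :
    Measurable[𝔽 t] fun ω => M.reserve x (θ ω) ω :=
  measurable_eval_of_rightContinuous (t := t) hθ (fun ω => ENNReal.coe_le_coe.2 (hθt ω))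
    (fun s hs => (M.measurable_reserve x s).mono (𝔽.mono (ENNReal.coe_le_coe.1 hs)) le_rfl)
    (M.reserve_rightContinuous x)

theorem isAdmissible_stopped (hα : M.IsAdmissible x α) {T : Ω → ℝ≥0∞}
    (hT : ∀ t, Measurable[𝔽 t] fun ω => stopTime (T ω) t) : M.IsAdmissible x (α.stopped T) where
  Z_adapted t := M.measurable_eval_Z hα (hT t) fun _ => stopTime_le _ _
  K_adapted t := M.measurable_eval_K hα (hT t) fun _ => stopTime_le _ _
  dividend_le ω t := by
    rw [dividend_le_iff]
    rcases le_or_gt (t : ℝ≥0∞) (T ω) with h | h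
    · have h1 : prelimit 0 (fun s => (α.stopped T).Z s ω) t = prelimit 0 (fun s => α.Z s ω) t :=
        prelimit_congr (fun ht => (α.Z_mono ω).tendsto_prelimit ht 0) fun s hs => by
          simp only [Strategy.stopped, stopTime_of_le ((ENNReal.coe_le_coe.2 hs.le).trans h)]
      rw [h1]
      simpa only [Strategy.stopped, stopTime_of_le h] using hα.dividend_le_max M ω t
    · refine le_max_of_le_left (le_of_eq (prelimit_eq_of_tendsto ?_ ?_).symm)
      · rintro rfl
        simp at h
      · refine tendsto_const_nhds.congr' ?_
        have : ∀ᶠ s : ℝ≥0 in 𝓝[<] t, T ω < s := mem_nhdsWithin_of_mem_nhds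
          ((isOpen_lt continuous_const ENNReal.continuous_coe).mem_nhds h)
        filter_upwards [this] with s hs
        simp only [Strategy.stopped, stopTime_eq_stopTime hs.le h.le]

theorem surplusAfter_stopped {T : Ω → ℝ≥0∞} {t : ℝ≥0} (h : (t : ℝ≥0∞) < T ω) :
    M.surplusAfter x (α.stopped T) t ω = M.surplusAfter x α t ω := by
  have h1 := M.tendsto_surplus_right x α t ω
  rw [← surplusAfter_eq] at h1
  refine rightLim_eq_of_tendsto (h1.congr' ?_)
  have : ∀ᶠ s : ℝ≥0 in 𝓝[>] t, (s : ℝ≥0∞) < T ω := mem_nhdsWithin_of_mem_nhds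
    ((isOpen_lt ENNReal.continuous_coe continuous_const).mem_nhds h)
  filter_upwards [this] with s hs
  simp only [surplus, Strategy.stopped, stopTime_of_le hs.le]

/-! ### Deferring the injections between two claims -/

/-- The injections after the `n`-th claim, beyond the shortfall at that claim, plus `κ`. -/
noncomputable def excess (x κ : ℝ) (α : Strategy Ω) (n : ℕ) (t : ℝ≥0) (ω : Ω) : ℝ :=
  excessInjection (fun s => α.K s ω) (fun s => -M.surplus (x + κ) α s ω) κ (M.claimTime n ω) t

theorem monotone_excess (x κ : ℝ) (α : Strategy Ω) (n : ℕ) (ω : Ω) :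
    Monotone fun t => M.excess x κ α n t ω := monotone_excessInjection (α.K_mono ω)

theorem excess_leftContinuous (x κ : ℝ) (α : Strategy Ω) (n : ℕ) (ω : Ω) (t : ℝ≥0) :
    ContinuousWithinAt (fun s => M.excess x κ α n s ω) (Iic t) t :=
  excessInjection_leftContinuous (α.K_leftContinuous ω) t

theorem excess_zero (x κ : ℝ) (α : Strategy Ω) (n : ℕ) (ω : Ω) : M.excess x κ α n 0 ω = κ :=
  excessInjection_of_le (by simp)

theorem le_excess (x κ : ℝ) (α : Strategy Ω) (n : ℕ) (t : ℝ≥0) (ω : Ω) :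
    κ ≤ M.excess x κ α n t ω := le_excessInjection t

theorem measurable_excess (hα : M.IsAdmissible (x + κ) α) (n : ℕ) (t : ℝ≥0) :
    Measurable[𝔽 t] (M.excess x κ α n t) := by
  have hθ := M.measurable_stopTime_claimTime n t
  have hθt (ω : Ω) : stopTime (M.claimTime n ω) t ≤ t := stopTime_le _ _
  have hX : Measurable[𝔽 t] fun ω => M.surplus (x + κ) α (stopTime (M.claimTime n ω) t) ω :=
    ((M.measurable_eval_reserve _ hθ hθt).sub (M.measurable_eval_Z hα hθ hθt)).add
      (M.measurable_eval_K hα hθ hθt)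
  exact measurable_const.add (measurable_const.max (((hα.K_adapted t).sub
    (M.measurable_eval_K hα hθ hθt)).sub (measurable_const.max hX.neg)))

/-- The modification of `α` for an initial reserve reduced by `κ`: between the `n`-th and the next
claim only the shortfall at the `n`-th claim is injected. Dividends that the reserve no longer
covers are not paid, and the remaining difference is injected at the next claim. -/
noncomputable def defer (x κ : ℝ) (α : Strategy Ω) (n : ℕ) : Strategy Ω where
  Z t ω := deferredZ (fun s => α.Z s ω) (fun s => M.excess x κ α n s ω)
    (M.claimTime (n + 1) ω) t
  K t ω := deferredK (fun s => α.Z s ω) (fun s => α.K s ω) (fun s => M.excess x κ α n s ω) κ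
    (M.claimTime (n + 1) ω) t
  Z_mono ω := monotone_deferredZ (α.Z_mono ω) (M.monotone_excess x κ α n ω)
  Z_rightContinuous ω := deferredZ_rightContinuous (α.Z_mono ω) (M.monotone_excess x κ α n ω)
    (α.Z_rightContinuous ω)
  Z_zero_nonneg ω := deferredZ_nonneg_zero (α.Z_mono ω) (M.monotone_excess x κ α n ω)
  K_mono ω := monotone_deferredK (α.Z_mono ω) (M.monotone_excess x κ α n ω) (α.K_mono ω)
    (monotone_sub_excessInjection (α.K_mono ω))
  K_leftContinuous ω := deferredK_leftContinuous (α.K_leftContinuous ω)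
    (M.excess_leftContinuous x κ α n ω)
  K_zero ω := by
    rw [deferredK_of_le (by simp), α.K_zero, excess_zero]
    ring

theorem isAdmissible_defer (hκ : 0 ≤ κ) (hα : M.IsAdmissible (x + κ) α) (n : ℕ) :
    M.IsAdmissible x (M.defer x κ α n) := by
  have hmax (t : ℝ≥0) : Measurable[𝔽 t] fun ω => runMax (fun s => α.Z s ω)
      (fun s => M.excess x κ α n s ω) (stopTime (M.claimTime (n + 1) ω) t) :=
    measurable_eval_of_rightContinuous (t := t)
      (f := fun s ω => runMax (fun s => α.Z s ω) (fun s => M.excess x κ α n s ω) s)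
      (M.measurable_stopTime_claimTime (n + 1) t)
      (fun ω => ENNReal.coe_le_coe.2 (stopTime_le _ _))
      (fun s hs => measurable_runMax
        (fun r hr => (hα.Z_adapted r).mono
          (𝔽.mono (hr.trans (ENNReal.coe_le_coe.1 hs))) le_rfl)
        (fun r hr => (M.measurable_excess hα n r).mono
          (𝔽.mono (hr.trans (ENNReal.coe_le_coe.1 hs))) le_rfl)
        α.Z_mono (M.monotone_excess x κ α n) α.Z_rightContinuous
        (M.excess_leftContinuous x κ α n))
      fun ω => runMax_rightContinuous (α.Z_mono ω) (M.monotone_excess x κ α n ω)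
        (α.Z_rightContinuous ω)
  have hZσ (t : ℝ≥0) : Measurable[𝔽 t] fun ω => α.Z (stopTime (M.claimTime (n + 1) ω) t) ω :=
    M.measurable_eval_Z hα (M.measurable_stopTime_claimTime (n + 1) t) fun _ => stopTime_le _ _
  refine ⟨fun t => ((hα.Z_adapted t).sub (hZσ t)).add (hmax t), fun t => ?_, fun ω t => ?_⟩
  · refine Measurable.ite ?_ (((hα.K_adapted t).add measurable_const).sub
      (M.measurable_excess hα n t)) (((hα.K_adapted t).add measurable_const).sub
      ((hZσ t).sub (hmax t)))
    have : {ω | (t : ℝ≥0∞) ≤ M.claimTime (n + 1) ω} =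
        (fun ω => stopTime (M.claimTime (n + 1) ω) t) ⁻¹' Ici t := by
      ext ω
      rw [mem_ofPred_eq, mem_preimage, mem_Ici, ← ENNReal.coe_le_coe, coe_stopTime, le_min_iff,
        and_iff_right le_rfl]
    rw [this]
    exact M.measurable_stopTime_claimTime (n + 1) t measurableSet_Ici
  · rw [dividend_le_iff]
    refine deferredZ_le_max (K := fun s => α.K s ω) (σ := M.claimTime (n + 1) ω)
      (R := fun s => M.reserve x s ω) (α.Z_mono ω) (M.monotone_excess x κ α n ω)
      (M.excess_zero x κ α n ω) hκ (fun s => ?_) t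
    have := hα.dividend_le_max M ω s
    rwa [reserve_add] at this

/-- Until the ruin time of `α`, deferring injections does not lead to ruin. -/
theorem surplusAfter_defer_nonneg (hκ : 0 ≤ κ) (hα : M.IsAdmissible (x + κ) α) {n : ℕ}
    (hn : κ = 0 ∨ (0 ≤ x ∧ n = 0)) {t : ℝ≥0} (ht : (t : ℝ≥0∞) < M.ruinTime (x + κ) α ω) :
    0 ≤ M.surplusAfter x (M.defer x κ α n) t ω := by
  have hZ := α.Z_mono ω
  have hK := α.K_mono ω
  have hk := M.monotone_excess x κ α n ω
  rcases le_or_gt (M.claimTime (n + 1) ω) t with hσ | hσ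
  -- After the catch-up injection, the missing injections and the missing dividends cancel and both
  -- surpluses agree.
  · have h1 := M.tendsto_surplus_right x (M.defer x κ α n) t ω
    have h2 := M.tendsto_surplus_right (x + κ) α t ω
    rw [← surplusAfter_eq] at h1 h2
    refine (M.surplusAfter_nonneg ht).trans_eq (tendsto_nhds_unique h2 (h1.congr' ?_))
    filter_upwards [self_mem_nhdsWithin] with s hs
    have h3 : M.claimTime (n + 1) ω < s := hσ.trans_lt (ENNReal.coe_lt_coe.2 hs)
    simp only [surplus, defer, deferredK_of_lt h3, deferredZ, reserve_add]
    ring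
  · rw [surplusAfter_eq]
    suffices h : ∀ᶠ s in 𝓝[>] t, runMax (fun s => α.Z s ω) (fun s => M.excess x κ α n s ω) t ≤
        M.reserve x t ω + (α.K s ω + κ - M.excess x κ α n s ω) by
      have h1 : M.reserve x t ω - (M.defer x κ α n).Z t ω = M.reserve x t ω -
          runMax (fun s => α.Z s ω) (fun s => M.excess x κ α n s ω) t := by
        simp only [defer, deferredZ_of_le hσ.le]
      rw [h1]
      refine ge_of_tendsto
        ((((M.defer x κ α n).K_mono ω).tendsto_rightLim t).const_add _) ?_
      have h2 : ∀ᶠ s : ℝ≥0 in 𝓝[>] t, (s : ℝ≥0∞) < M.claimTime (n + 1) ω :=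
        mem_nhdsWithin_of_mem_nhds
          ((isOpen_lt ENNReal.continuous_coe continuous_const).mem_nhds hσ)
      filter_upwards [h, h2] with s hs hsσ
      simp only [defer, deferredK_of_le hsσ.le]
      linarith
    rcases lt_or_ge (t : ℝ≥0∞) (M.claimTime n ω) with hτ | hτ
    -- Before the $n$-th claim nothing may be missing: for $n=0$ there is no such time, and for
    -- $\kappa=0$ nothing has been deferred yet.
    · have hκ0 : κ = 0 := hn.resolve_right fun h => by
        rw [h.2, claimTime_zero] at hτ
        exact not_lt_bot hτ
      subst hκ0
      have h2 : ∀ᶠ s : ℝ≥0 in 𝓝[>] t, (s : ℝ≥0∞) < M.claimTime n ω :=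
        mem_nhdsWithin_of_mem_nhds
          ((isOpen_lt ENNReal.continuous_coe continuous_const).mem_nhds hτ)
      filter_upwards [h2, self_mem_nhdsWithin] with s hsτ hs
      have h3 : M.excess x 0 α n s ω = 0 := excessInjection_of_le hsτ.le
      have h4 := M.Z_le_of_lt_ruinTime ht hs
      rw [add_zero] at h4
      rw [h3, add_zero, sub_zero]
      refine (runMax_le (α.Z_nonneg t ω) fun r hr => ?_).trans h4
      linarith [hZ hr, M.le_excess x 0 α n r ω]
    · obtain ⟨τ, hτeq⟩ : ∃ τ : ℝ≥0, M.claimTime n ω = τ :=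
        ⟨_, (ENNReal.coe_toNNReal (ne_top_of_le_ne_top ENNReal.coe_ne_top hτ)).symm⟩
      have hτt : τ ≤ t := by rwa [hτeq, ENNReal.coe_le_coe] at hτ
      have hNτ : n ≤ M.N τ ω := M.claimTime_le_iff.1 hτeq.le
      have hNt : M.N t ω ≤ n := Nat.lt_succ_iff.1 (M.lt_claimTime_iff.1 hσ)
      have hN (r : ℝ≥0) (h1 : τ ≤ r) (h2 : r ≤ t) : M.N r ω = n :=
        le_antisymm ((M.N_mono ω h2).trans hNt) (hNτ.trans (M.N_mono ω h1))
      have hexc (s : ℝ≥0) (hs : τ ≤ s) : M.excess x κ α n s ω = κ + max 0 (α.K s ω - α.K τ ω -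
          max 0 (-M.surplus (x + κ) α τ ω)) := by
        simp only [excess, excessInjection, hτeq, stopTime_coe, min_eq_right hs]
      -- `B` is the level of cumulative injections that just covers the shortfall at the claim. The
      -- modified strategy stays there until the next claim.
      set B := α.K τ ω + max 0 (-M.surplus (x + κ) α τ ω) with hB
      have hB1 : α.K τ ω ≤ B := by linarith [le_max_left 0 (-M.surplus (x + κ) α τ ω)]
      have hB2 : α.Z τ ω ≤ κ + M.reserve x τ ω + B := by
        have := le_max_right 0 (-M.surplus (x + κ) α τ ω)
        rw [surplus, reserve_add] at this
        rw [hB, surplus, reserve_add]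
        linarith
      have hτT : (τ : ℝ≥0∞) < M.ruinTime (x + κ) α ω := (ENNReal.coe_le_coe.2 hτt).trans_lt ht
      have hRt (r : ℝ≥0) (h1 : τ ≤ r) (h2 : r ≤ t) : M.reserve x r ω ≤ M.reserve x t ω :=
        M.reserve_le_reserve x h2 ((hN r h1 h2).trans (hN t hτt le_rfl).symm)
      filter_upwards [self_mem_nhdsWithin] with s hs
      have hτs : τ < s := hτt.trans_lt hs
      have hBs : B ≤ α.K s ω := by
        have h1 := M.Z_le_of_lt_ruinTime hτT hτs
        have h2 := hK hτs.le
        have h3 : max 0 (-M.surplus (x + κ) α τ ω) ≤ α.K s ω - α.K τ ω :=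
          max_le (sub_nonneg.2 h2) (by rw [surplus]; linarith)
        linarith
      have hexs : α.K s ω + κ - M.excess x κ α n s ω = B := by
        rw [hexc s hτs.le, max_eq_right (by linarith)]
        linarith
      rw [hexs]
      refine runMax_le ?_ fun r hr => ?_
      -- The reserve plus `B` must be nonnegative. For $\kappa=0$ this follows from $0\le Z_\tau\le
      -- R_\tau+B$, for $n=0$ from $x\ge 0$.
      · rcases hn with rfl | ⟨hx, rfl⟩
        · linarith [hRt τ le_rfl hτt, α.Z_nonneg τ ω]
        · have h1 : M.reserve x t ω = x + p.c * t := by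
            rw [reserve_eq, claims, hN t hτt le_rfl]
            simp
          have h2 : 0 ≤ p.c * t := mul_nonneg p.c_pos.le t.2
          linarith [α.K_nonneg τ ω]
      -- For $r\le\tau$ the bound on $Z_\tau$ suffices. For $r>\tau$ solvency of $\alpha$ at $r$
      -- bounds $Z_r$ through $K_r$, whose part above `B` is contained in the excess.
      · rcases le_or_gt r τ with hrτ | hrτ
        · linarith [hZ hrτ, M.le_excess x κ α n r ω, hRt τ le_rfl hτt]
        · have h1 := M.surplus_nonneg hα ((ENNReal.coe_le_coe.2 hr).trans ht.le) hrτ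
            ((hN τ le_rfl hτt).trans (hN r hrτ.le hr).symm)
          rw [surplus, reserve_add] at h1
          rw [hexc r hrτ.le]
          linarith [le_max_right 0 (α.K r ω - α.K τ ω - max 0 (-M.surplus (x + κ) α τ ω)),
            hRt r hrτ.le hr]

end HawkesClaims

/-! ### Injections up to and including a random time, and iterated integrals -/

theorem stopAfter_le {g : ℝ≥0 → ℝ} (hg : Monotone g) (T : ℝ≥0∞) (t : ℝ≥0) :
    stopAfter g T t ≤ g t := by
  unfold stopAfter
  split_ifs with h
  · exact le_rfl
  · refine hg.rightLim_le ?_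
    rw [not_le] at h
    rwa [← ENNReal.coe_lt_coe, ENNReal.coe_toNNReal h.ne_top]

theorem tendsto_stopAfter {g : ℝ≥0 → ℝ} (hg : Monotone g) (T : ℝ≥0∞) (t : ℝ≥0) :
    Tendsto (fun n : ℕ => g (stopTime (T + ((1 / ((n : ℝ≥0) + 1) : ℝ≥0) : ℝ≥0∞)) t)) atTop
      (𝓝 (stopAfter g T t)) := by
  unfold stopAfter
  split_ifs with h
  · refine tendsto_const_nhds.congr fun n => ?_
    rw [stopTime_of_le (h.trans le_self_add)]
  · rw [not_le] at h
    lift T to ℝ≥0 using h.ne_top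
    rw [ENNReal.coe_lt_coe] at h
    simp only [← ENNReal.coe_add, stopTime_coe, ENNReal.toNNReal_coe]
    refine (hg.tendsto_rightLim T).comp (tendsto_nhdsWithin_iff.2
      ⟨?_, Eventually.of_forall fun n => lt_min h (lt_add_of_pos_right _ (by positivity))⟩)
    have h1 : Tendsto (fun n : ℕ => T + 1 / ((n : ℝ≥0) + 1)) atTop (𝓝 (T + 0)) :=
      tendsto_const_nhds.add tendsto_one_div_add_atTop_nhds_zero_nat
    have h2 := (tendsto_const_nhds (x := t)).min h1
    rwa [add_zero, min_eq_right h.le] at h2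

theorem measurable_stopTime {Ω : Type*} {m : MeasurableSpace Ω} {T : Ω → ℝ≥0∞}
    (hT : Measurable T) : Measurable fun z : Ω × ℝ≥0 => stopTime (T z.1) z.2 :=
  (measurable_snd.coe_nnreal_ennreal.min (hT.comp measurable_fst)).ennreal_toNNReal

/-- Superadditivity of the lower integral needs no measurability, so the stopped dividends never
have to be shown jointly measurable. -/
theorem lintegral_lintegral_add_le {Ω : Type*} {m : MeasurableSpace Ω} (P : Measure Ω)
    (ν : Measure ℝ≥0) (f g : Ω → ℝ≥0 → ℝ≥0∞) :
    ∫⁻ ω, ∫⁻ u, f ω u ∂ν ∂P + ∫⁻ ω, ∫⁻ u, g ω u ∂ν ∂P ≤ ∫⁻ ω, ∫⁻ u, f ω u + g ω u ∂ν ∂P :=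
  (le_lintegral_add _ _).trans (lintegral_mono fun _ => le_lintegral_add _ _)

theorem lintegral_lintegral_add_right {Ω : Type*} {m : MeasurableSpace Ω} (P : Measure Ω)
    (ν : Measure ℝ≥0) [SFinite ν] (f : Ω → ℝ≥0 → ℝ≥0∞) {g : Ω → ℝ≥0 → ℝ≥0∞}
    (hg : Measurable (Function.uncurry g)) :
    ∫⁻ ω, ∫⁻ u, f ω u + g ω u ∂ν ∂P = ∫⁻ ω, ∫⁻ u, f ω u ∂ν ∂P + ∫⁻ ω, ∫⁻ u, g ω u ∂ν ∂P := by
  have h : Measurable fun ω => ∫⁻ u, g ω u ∂ν := hg.lintegral_prod_right'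
  rw [← lintegral_add_right _ h]
  exact lintegral_congr fun ω => lintegral_add_right _ (hg.comp measurable_prodMk_left)

namespace HawkesClaims

variable {p : RiskParams} {y : ℝ} {Ω : Type*} [m : MeasurableSpace Ω] {P : Measure Ω}
  {𝔽 : Filtration ℝ≥0 m} (M : HawkesClaims p y P 𝔽) {x κ : ℝ} {α : Strategy Ω} {ω : Ω}

/-! ### The reward as a double integral -/

/-- Cumulative injections up to time `u`, including a lump sum at ruin if ruin occurs
before `u`. -/
noncomputable def paidInjections (x : ℝ) (α : Strategy Ω) (ω : Ω) (u : ℝ≥0) : ℝ :=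
  stopAfter (fun s => α.K s ω) (M.ruinTime x α ω) u

theorem le_paidInjections (x : ℝ) (α : Strategy Ω) (ω : Ω) (u : ℝ≥0) :
    α.K (stopTime (M.ruinTime x α ω) u) ω ≤ M.paidInjections x α ω u :=
  le_stopAfter (α.K_mono ω) _ _

theorem paidInjections_nonneg (x : ℝ) (α : Strategy Ω) (ω : Ω) (u : ℝ≥0) :
    0 ≤ M.paidInjections x α ω u := (α.K_nonneg _ _).trans (M.le_paidInjections x α ω u)

theorem measurable_eval_prod_K (hα : M.IsAdmissible x α) {θ : Ω × ℝ≥0 → ℝ≥0}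
    (hθ : Measurable θ) : Measurable fun z => α.K (θ z) z.1 :=
  measurable_eval_of_leftContinuous (t := ⊤) (f := fun s z => α.K s z.1) hθ (fun _ => le_top)
    (fun s _ => ((hα.K_adapted s).mono (𝔽.le s) le_rfl).comp (f := Prod.fst) measurable_fst)
    fun z => α.K_leftContinuous z.1

theorem measurable_paidInjections (hα : M.IsAdmissible x α) :
    Measurable (Function.uncurry (M.paidInjections x α)) :=
  measurable_of_tendsto_metrizable (fun _ => M.measurable_eval_prod_K hα
      (measurable_stopTime ((M.measurable_ruinTime hα).add_const _)))
    (tendsto_pi_nhds.2 fun z => tendsto_stopAfter (α.K_mono z.1) _ _)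

theorem expectedDividends_eq (x : ℝ) (α : Strategy Ω) : M.expectedDividends x α =
    ∫⁻ ω, ∫⁻ u, ENNReal.ofReal (α.Z (stopTime (M.ruinTime x α ω) u) ω) ∂discountMeasure p.ρ
      ∂P := by
  refine lintegral_congr fun ω => ?_
  rw [Strategy.dZ, lintegral_exp_pathMeasure_Iic _ _ p.ρ_pos]
  exact lintegral_congr fun u => pathMeasure_Iic_of_rightContinuous _ _ (α.Z_rightContinuous ω) _

theorem expectedInjections_eq (x : ℝ) (α : Strategy Ω) : M.expectedInjections x α =
    ∫⁻ ω, ∫⁻ u, ENNReal.ofReal (M.paidInjections x α ω u) ∂discountMeasure p.ρ ∂P := by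
  refine lintegral_congr fun ω => ?_
  rw [Strategy.dK, lintegral_exp_pathMeasure_Iio _ _ p.ρ_pos]
  exact lintegral_congr fun u =>
    pathMeasure_le_inter_Iio _ _ (α.K_leftContinuous ω) (α.K_zero ω) _ _

theorem reward_eq_bot (h : M.expectedInjections x α = ⊤) : M.reward x α = ⊥ := by
  rw [reward, h, EReal.coe_ennreal_top, EReal.coe_mul_top_of_pos (one_pos.trans p.one_lt_δ),
    EReal.sub_top]

theorem reward_eq_coe (hI : M.expectedInjections x α ≠ ⊤) (hD : M.expectedDividends x α ≠ ⊤) :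
    M.reward x α = (((M.expectedDividends x α).toReal -
      p.δ * (M.expectedInjections x α).toReal : ℝ) : EReal) := by
  rw [reward, EReal.coe_sub, EReal.coe_mul, EReal.coe_ennreal_toReal hI,
    EReal.coe_ennreal_toReal hD]

/-! ### Finiteness of the value function -/

/-- An upper bound for the value function. -/
noncomputable def dividendBound (p : RiskParams) (x : ℝ) : ℝ≥0∞ :=
  ENNReal.ofReal (max 0 x) + ENNReal.ofReal p.c * ∫⁻ u, (u : ℝ≥0∞) ∂discountMeasure p.ρ

theorem dividendBound_ne_top (p : RiskParams) (x : ℝ) : dividendBound p x ≠ ⊤ :=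
  ENNReal.add_ne_top.2 ⟨ENNReal.ofReal_ne_top, ENNReal.mul_ne_top ENNReal.ofReal_ne_top
    (lintegral_coe_discountMeasure_lt_top p.ρ_pos).ne⟩

/-- The pathwise financing bound, read at the exponential clock. With $\delta>1$ it bounds the value
function from above, so rewards can be compared as real numbers. -/
theorem expectedDividends_le [IsProbabilityMeasure P] (hα : M.IsAdmissible x α) :
    M.expectedDividends x α ≤ dividendBound p x + M.expectedInjections x α := by
  have := isProbabilityMeasure_discountMeasure p.ρ_pos
  have hm : Measurable (Function.uncurry fun ω u => ENNReal.ofReal (M.paidInjections x α ω u)) :=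
    (M.measurable_paidInjections hα).ennreal_ofReal
  have hb : dividendBound p x = ∫⁻ _ : Ω, ∫⁻ u : ℝ≥0, (ENNReal.ofReal (max 0 x) +
      ENNReal.ofReal p.c * (u : ℝ≥0∞)) ∂discountMeasure p.ρ ∂P := by
    rw [lintegral_const, measure_univ, mul_one, lintegral_add_left measurable_const,
      lintegral_const, measure_univ, mul_one, lintegral_const_mul _ (by fun_prop), dividendBound]
  rw [expectedDividends_eq, expectedInjections_eq, hb, ← lintegral_lintegral_add_right _ _ _ hm]
  refine lintegral_mono fun ω => lintegral_mono fun u => ?_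
  have h1 := M.Z_le_of_le_ruinTime hα (coe_stopTime_le (M.ruinTime x α ω) u)
  have h2 := M.le_paidInjections x α ω u
  have h3 : p.c * stopTime (M.ruinTime x α ω) u ≤ p.c * u :=
    mul_le_mul_of_nonneg_left (NNReal.coe_le_coe.2 (stopTime_le _ _)) p.c_pos.le
  have h4 : 0 ≤ p.c * u := mul_nonneg p.c_pos.le u.2
  rw [← ENNReal.ofReal_coe_nnreal, ← ENNReal.ofReal_mul p.c_pos.le,
    ← ENNReal.ofReal_add (le_max_left _ _) h4,
    ← ENNReal.ofReal_add (add_nonneg (le_max_left _ _) h4) (M.paidInjections_nonneg x α ω u)]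
  exact ENNReal.ofReal_le_ofReal (by linarith)

theorem expectedDividends_ne_top [IsProbabilityMeasure P] (hα : M.IsAdmissible x α)
    (hI : M.expectedInjections x α ≠ ⊤) : M.expectedDividends x α ≠ ⊤ :=
  ne_top_of_le_ne_top (ENNReal.add_ne_top.2 ⟨dividendBound_ne_top p x, hI⟩)
    (M.expectedDividends_le hα)

theorem value_le [IsProbabilityMeasure P] (x : ℝ) :
    M.value x ≤ ((dividendBound p x).toReal : ℝ) := by
  refine iSup₂_le fun α hα => ?_
  by_cases hI : M.expectedInjections x α = ⊤
  · rw [M.reward_eq_bot hI]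
    exact bot_le
  · have hD := M.expectedDividends_ne_top hα hI
    rw [M.reward_eq_coe hI hD, EReal.coe_le_coe_iff]
    have h1 := ENNReal.toReal_mono (ENNReal.add_ne_top.2 ⟨dividendBound_ne_top p x, hI⟩)
      (M.expectedDividends_le hα)
    rw [ENNReal.toReal_add (dividendBound_ne_top p x) hI] at h1
    have h2 := p.one_lt_δ
    nlinarith [ENNReal.toReal_nonneg (a := M.expectedInjections x α)]

/-- The strategy without dividends and injections. -/
noncomputable def _root_.Strategy.zero : Strategy Ω where
  Z _ _ := 0
  K _ _ := 0
  Z_mono _ := monotone_const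
  Z_rightContinuous _ _ := continuousWithinAt_const
  Z_zero_nonneg _ := le_rfl
  K_mono _ := monotone_const
  K_leftContinuous _ _ := continuousWithinAt_const
  K_zero _ := rfl

theorem isAdmissible_zero (x : ℝ) : M.IsAdmissible x Strategy.zero where
  Z_adapted _ := measurable_const
  K_adapted _ := measurable_const
  dividend_le ω t := by
    have h : prelimit 0 (fun s => (Strategy.zero : Strategy Ω).Z s ω) t = 0 := by
      by_cases ht : t = 0
      · rw [ht, prelimit_zero]
      · exact prelimit_eq_of_tendsto ht tendsto_const_nhds
    rw [h, sub_zero]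
    exact le_max_left _ _

theorem bot_lt_value (x : ℝ) : ⊥ < M.value x := by
  refine lt_of_lt_of_le ?_ (le_iSup₂_of_le Strategy.zero (M.isAdmissible_zero x) le_rfl)
  have hI : M.expectedInjections x Strategy.zero = 0 := by
    rw [expectedInjections_eq, ← lintegral_zero (μ := P)]
    refine lintegral_congr fun ω => ?_
    rw [← lintegral_zero (μ := discountMeasure p.ρ)]
    refine lintegral_congr fun u => ENNReal.ofReal_of_nonpos (stopAfter_le monotone_const _ _)
  have hD : M.expectedDividends x Strategy.zero = 0 := by
    rw [expectedDividends_eq]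
    simp [Strategy.zero]
  rw [M.reward_eq_coe (by simp [hI]) (by simp [hD])]
  exact EReal.bot_lt_coe _

theorem exists_value_eq [IsProbabilityMeasure P] (x : ℝ) : ∃ r : ℝ, M.value x = r :=
  ⟨(M.value x).toReal, (EReal.coe_toReal ((M.value_le x).trans_lt (EReal.coe_lt_top _)).ne
    (M.bot_lt_value x).ne').symm⟩

/-! ### The gain from deferring injections -/

/-- The gain from deferring injections, as accumulated until time `u`. -/
noncomputable def gain (x κ : ℝ) (α : Strategy Ω) (n : ℕ) (ω : Ω) (u : ℝ≥0) : ℝ :=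
  (if (stopTime (M.ruinTime (x + κ) α ω) u : ℝ≥0∞) ≤ M.claimTime (n + 1) ω then
      (p.δ - 1) * M.excess x κ α n (stopTime (M.ruinTime (x + κ) α ω) u) ω else 0) +
    p.δ * (M.paidInjections (x + κ) α ω u - α.K (stopTime (M.ruinTime (x + κ) α ω) u) ω)

theorem excess_nonneg (hκ : 0 ≤ κ) (x : ℝ) (α : Strategy Ω) (n : ℕ) (t : ℝ≥0) (ω : Ω) :
    0 ≤ M.excess x κ α n t ω := hκ.trans (M.le_excess x κ α n t ω)

theorem gain_nonneg (hκ : 0 ≤ κ) (x : ℝ) (α : Strategy Ω) (n : ℕ) (ω : Ω) (u : ℝ≥0) :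
    0 ≤ M.gain x κ α n ω u := by
  have h1 := M.excess_nonneg hκ x α n (stopTime (M.ruinTime (x + κ) α ω) u) ω
  have h2 := M.le_paidInjections (x + κ) α ω u
  have h3 := p.one_lt_δ
  refine add_nonneg ?_ (mul_nonneg (by linarith) (by linarith))
  split_ifs
  · exact mul_nonneg (by linarith) h1
  · exact le_rfl

theorem measurable_claimTime (n : ℕ) : Measurable (M.claimTime n) := by
  refine measurable_of_Iic fun r => ?_
  induction r with
  | top => simp
  | coe t =>
    have : M.claimTime n ⁻¹' Iic (t : ℝ≥0∞) = M.N t ⁻¹' Ici n := by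
      ext ω
      exact M.claimTime_le_iff
    rw [this]
    exact 𝔽.le t _ (M.N_adapted t measurableSet_Ici)

theorem measurable_gain (hα : M.IsAdmissible (x + κ) α) (n : ℕ) :
    Measurable (Function.uncurry (M.gain x κ α n)) := by
  have hθ := measurable_stopTime (M.measurable_ruinTime hα)
  refine (Measurable.ite (measurableSet_le hθ.coe_nnreal_ennreal
    ((M.measurable_claimTime (n + 1)).comp measurable_fst)) (Measurable.const_mul ?_ _)
    measurable_const).add (((M.measurable_paidInjections hα).sub
      (M.measurable_eval_prod_K hα hθ)).const_mul _)
  exact measurable_eval_of_leftContinuous (t := ⊤) (f := fun s z => M.excess x κ α n s z.1) hθ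
    (fun _ => le_top)
    (fun s _ => ((M.measurable_excess hα n s).mono (𝔽.le s) le_rfl).comp (f := Prod.fst)
      measurable_fst)
    fun z => M.excess_leftContinuous x κ α n z.1

/-- The expected discounted gain from deferring injections. -/
noncomputable def expectedGain (x κ : ℝ) (α : Strategy Ω) (n : ℕ) : ℝ≥0∞ :=
  ∫⁻ ω, ∫⁻ u, ENNReal.ofReal (M.gain x κ α n ω u) ∂discountMeasure p.ρ ∂P

/-- The competitor is the deferred strategy stopped at the ruin time $T$ of `α`. It survives up to
$T$ and does nothing afterwards, so both strategies can be compared at the same time $T\wedge u$,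
for each value $u$ of the clock. -/
theorem exists_improvement [IsProbabilityMeasure P] (hκ : 0 ≤ κ) (hα : M.IsAdmissible (x + κ) α)
    {n : ℕ} (hn : κ = 0 ∨ (0 ≤ x ∧ n = 0)) (hI : M.expectedInjections (x + κ) α ≠ ⊤) :
    ∃ r : ℝ, M.reward (x + κ) α = r ∧ M.expectedGain x κ α n ≠ ⊤ ∧
      ((r + (M.expectedGain x κ α n).toReal - p.δ * κ : ℝ) : EReal) ≤ M.value x := by
  have := isProbabilityMeasure_discountMeasure p.ρ_pos
  have hδ : 0 < p.δ := one_pos.trans p.one_lt_δ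
  have hD := M.expectedDividends_ne_top hα hI
  set T : Ω → ℝ≥0∞ := fun ω => M.ruinTime (x + κ) α ω with hT
  set β := (M.defer x κ α n).stopped T with hβ
  have hβa : M.IsAdmissible x β := M.isAdmissible_stopped (M.isAdmissible_defer hκ hα n)
    (M.measurable_stopTime_ruinTime hα)
  have hTβ (ω : Ω) : T ω ≤ M.ruinTime x β ω := M.le_ruinTime fun t ht => by
    rw [hβ, M.surplusAfter_stopped ht]
    exact M.surplusAfter_defer_nonneg hκ hα hn ht
  have hm : Measurable (Function.uncurry
      fun ω u => ENNReal.ofReal (M.paidInjections (x + κ) α ω u)) :=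
    (M.measurable_paidInjections hα).ennreal_ofReal
  have hk (ω : Ω) (t : ℝ≥0) : 0 ≤ M.excess x κ α n t ω := M.excess_nonneg hκ x α n t ω
  have hZβ (ω : Ω) (u : ℝ≥0) :
      β.Z (stopTime (M.ruinTime x β ω) u) ω = (M.defer x κ α n).Z (stopTime (T ω) u) ω := by
    have h : stopTime (T ω) (stopTime (M.ruinTime x β ω) u) = stopTime (T ω) u := by
      rw [← ENNReal.coe_inj, coe_stopTime, coe_stopTime, coe_stopTime, min_assoc,
        min_eq_right (hTβ ω)]
    rw [← h]
    rfl
  -- The stopped strategy omits an injection made right after $T$. The original pays for it, which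
  -- accounts for the second summand of `gain`.
  have hKβ (ω : Ω) (u : ℝ≥0) :
      M.paidInjections x β ω u ≤ (M.defer x κ α n).K (stopTime (T ω) u) ω :=
    stopAfter_le (β.K_mono ω) _ _
  have hDβ : M.expectedDividends x β ≤ M.expectedDividends (x + κ) α := by
    rw [expectedDividends_eq, expectedDividends_eq]
    refine lintegral_mono fun ω => lintegral_mono fun u => ENNReal.ofReal_le_ofReal ?_
    rw [hZβ]
    exact deferredZ_le (α.Z_mono ω) (α.Z_zero_nonneg ω) (hk ω) _
  have hIβ : M.expectedInjections x β ≤ ENNReal.ofReal κ + M.expectedInjections (x + κ) α := by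
    have hc : ENNReal.ofReal κ = ∫⁻ _ : Ω, ∫⁻ _ : ℝ≥0, ENNReal.ofReal κ ∂discountMeasure p.ρ ∂P := by
      simp
    rw [expectedInjections_eq, expectedInjections_eq, hc,
      ← lintegral_lintegral_add_right _ _ _ hm]
    refine lintegral_mono fun ω => lintegral_mono fun u => ?_
    rw [← ENNReal.ofReal_add hκ (M.paidInjections_nonneg _ _ _ _)]
    refine ENNReal.ofReal_le_ofReal ((hKβ ω u).trans ?_)
    have h1 := deferredK_le (K := fun s => α.K s ω) (κ := κ) (σ := M.claimTime (n + 1) ω)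
      (α.Z_mono ω) (α.Z_zero_nonneg ω) (hk ω) (stopTime (T ω) u)
    have h2 := M.le_paidInjections (x + κ) α ω u
    simp only [defer]
    linarith
  -- Written without subtraction in `ℝ≥0∞`; finiteness of the right side then also gives finiteness
  -- of the gain.
  have key : M.expectedDividends (x + κ) α + ENNReal.ofReal p.δ * M.expectedInjections x β +
      M.expectedGain x κ α n ≤ M.expectedDividends x β + ENNReal.ofReal (p.δ * κ) +
        ENNReal.ofReal p.δ * M.expectedInjections (x + κ) α := by
    have hc : ENNReal.ofReal (p.δ * κ) =
        ∫⁻ _ : Ω, ∫⁻ _ : ℝ≥0, ENNReal.ofReal (p.δ * κ) ∂discountMeasure p.ρ ∂P := by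
      simp
    have hmul (f : Ω → ℝ≥0 → ℝ≥0∞) :
        ENNReal.ofReal p.δ * ∫⁻ ω, ∫⁻ u, f ω u ∂discountMeasure p.ρ ∂P =
          ∫⁻ ω, ∫⁻ u, ENNReal.ofReal p.δ * f ω u ∂discountMeasure p.ρ ∂P := by
      rw [← lintegral_const_mul' _ _ ENNReal.ofReal_ne_top]
      exact lintegral_congr fun ω => (lintegral_const_mul' _ _ ENNReal.ofReal_ne_top).symm
    have hm' : Measurable (Function.uncurry
        fun ω u => ENNReal.ofReal p.δ * ENNReal.ofReal (M.paidInjections (x + κ) α ω u)) :=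
      hm.const_mul _
    have hmc : Measurable (Function.uncurry
        fun (_ : Ω) (_ : ℝ≥0) => ENNReal.ofReal (p.δ * κ)) := measurable_const
    rw [expectedInjections_eq, expectedInjections_eq, hmul, hmul, hc, expectedDividends_eq,
      expectedDividends_eq, ← lintegral_lintegral_add_right _ _ _ hmc,
      ← lintegral_lintegral_add_right _ _ _ hm']
    -- The smaller side is merged by superadditivity; the larger side was merged exactly, using
    -- measurability of constants and of the injections of `α`.
    refine ((add_le_add_left (lintegral_lintegral_add_le _ _ _ _) _).trans
      (lintegral_lintegral_add_le _ _ _ _)).trans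
      (lintegral_mono fun ω => lintegral_mono fun u => ?_)
    have h1 := add_le_deferred (K := fun s => α.K s ω) (κ := κ) (σ := M.claimTime (n + 1) ω)
      (α.Z_mono ω) (M.monotone_excess x κ α n ω) p.one_lt_δ.le (α.Z_zero_nonneg ω) (hk ω)
      (stopTime (T ω) u)
    have h2 := mul_le_mul_of_nonneg_left (hKβ ω u) hδ.le
    have hg := M.gain_nonneg hκ x α n ω u
    have hK := M.paidInjections_nonneg x β ω u
    have hK' := M.paidInjections_nonneg (x + κ) α ω u
    have hZ := α.Z_nonneg (stopTime (M.ruinTime (x + κ) α ω) u) ω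
    have hZ' := β.Z_nonneg (stopTime (M.ruinTime x β ω) u) ω
    rw [← ENNReal.ofReal_mul hδ.le, ← ENNReal.ofReal_mul hδ.le,
      ← ENNReal.ofReal_add hZ (by positivity), ← ENNReal.ofReal_add (by positivity) hg,
      ← ENNReal.ofReal_add hZ' (by positivity),
      ← ENNReal.ofReal_add (by positivity) (by positivity)]
    refine ENNReal.ofReal_le_ofReal ?_
    rw [hZβ]
    simp only [defer] at h1 h2 ⊢
    unfold gain
    simp only [hT] at h1 h2 ⊢
    linarith
  have hDβt := ne_top_of_le_ne_top hD hDβ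
  have hIβt := ne_top_of_le_ne_top (ENNReal.add_ne_top.2 ⟨ENNReal.ofReal_ne_top, hI⟩) hIβ
  have hR : M.expectedDividends x β + ENNReal.ofReal (p.δ * κ) +
        ENNReal.ofReal p.δ * M.expectedInjections (x + κ) α ≠ ⊤ :=
    ENNReal.add_ne_top.2 ⟨ENNReal.add_ne_top.2 ⟨hDβt, ENNReal.ofReal_ne_top⟩,
      ENNReal.mul_ne_top ENNReal.ofReal_ne_top hI⟩
  have hG : M.expectedGain x κ α n ≠ ⊤ := ne_top_of_le_ne_top hR (le_add_self.trans key)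
  refine ⟨_, M.reward_eq_coe hI hD, hG, le_iSup₂_of_le β hβa ?_⟩
  rw [M.reward_eq_coe hIβt hDβt, EReal.coe_le_coe_iff]
  have h := ENNReal.toReal_mono hR key
  have hIm := ENNReal.mul_ne_top (ENNReal.ofReal_ne_top (r := p.δ)) hI
  have hIm' := ENNReal.mul_ne_top (ENNReal.ofReal_ne_top (r := p.δ)) hIβt
  rw [ENNReal.toReal_add (ENNReal.add_ne_top.2 ⟨hD, hIm'⟩) hG, ENNReal.toReal_add hD hIm',
    ENNReal.toReal_add (ENNReal.add_ne_top.2 ⟨hDβt, ENNReal.ofReal_ne_top⟩) hIm,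
    ENNReal.toReal_add hDβt ENNReal.ofReal_ne_top, ENNReal.toReal_mul, ENNReal.toReal_mul,
    ENNReal.toReal_ofReal hδ.le, ENNReal.toReal_ofReal (by positivity)] at h
  linarith

end HawkesClaims

/-! ### Null sets of the measure of a càglàd path -/

section NullSets

variable {g : ℝ≥0 → ℝ} (hg : Monotone g) (h0 : 0 ≤ g 0)
  (hc : ∀ t, ContinuousWithinAt g (Iic t) t) (hz : g 0 = 0)
include hc hz

theorem pathMeasure_Ioo_eq_zero {s t : ℝ≥0} (h : g t ≤ Function.rightLim g s) :
    pathMeasure hg h0 (Ioo (s : ℝ) t) = 0 := by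
  rcases le_or_gt t s with hts | hts
  · rw [Ioo_eq_empty (not_lt.2 (NNReal.coe_le_coe.2 hts)), measure_empty]
  · have h1 : Ioo (s : ℝ) t = Iio (t : ℝ) \ Iic (s : ℝ) := by
      ext r
      simp
    have h2 : Iic (s : ℝ) ⊆ Iio (t : ℝ) := Iic_subset_Iio.2 (NNReal.coe_lt_coe.2 hts)
    rw [h1, measure_sdiff h2
      measurableSet_Iic.nullMeasurableSet (by simp [pathMeasure_Iic]), pathMeasure_Iic,
      pathMeasure_Iio_of_leftContinuous hg h0 hc hz]
    exact tsub_eq_zero_of_le (ENNReal.ofReal_le_ofReal h)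

theorem pathMeasure_singleton_eq_zero {s : ℝ≥0} (h : Function.rightLim g s ≤ g s) :
    pathMeasure hg h0 {(s : ℝ)} = 0 := by
  have h1 : {(s : ℝ)} = Iic (s : ℝ) \ Iio (s : ℝ) := by simp
  rw [h1, measure_sdiff Iio_subset_Iic_self measurableSet_Iio.nullMeasurableSet
    (by simp [pathMeasure_Iio_of_leftContinuous hg h0 hc hz]), pathMeasure_Iic,
    pathMeasure_Iio_of_leftContinuous hg h0 hc hz]
  exact tsub_eq_zero_of_le (ENNReal.ofReal_le_ofReal h)

end NullSets

namespace HawkesClaims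

variable {p : RiskParams} {y : ℝ} {Ω : Type*} [m : MeasurableSpace Ω] {P : Measure Ω}
  {𝔽 : Filtration ℝ≥0 m} (M : HawkesClaims p y P 𝔽) {x κ : ℝ} {α : Strategy Ω} {ω : Ω}

/-! ### Strict preference for later injections -/

/-- A lower bound for the gain from deferring an initial injection `κ` until the first claim. -/
noncomputable def initialGain (κ : ℝ) : ℝ≥0∞ :=
  ∫⁻ ω, ∫⁻ u : ℝ≥0, ENNReal.ofReal
    (if (u : ℝ≥0∞) ≤ M.claimTime 1 ω then (p.δ - 1) * κ else 0) ∂discountMeasure p.ρ ∂P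

theorem initialGain_le_expectedGain (hκ : 0 ≤ κ) (x : ℝ) (α : Strategy Ω) :
    M.initialGain κ ≤ M.expectedGain x κ α 0 := by
  refine lintegral_mono fun ω => lintegral_mono fun u => ENNReal.ofReal_le_ofReal ?_
  split_ifs with h
  · have h1 : (stopTime (M.ruinTime (x + κ) α ω) u : ℝ≥0∞) ≤ M.claimTime (0 + 1) ω :=
      (ENNReal.coe_le_coe.2 (stopTime_le _ _)).trans h
    have h2 := M.le_paidInjections (x + κ) α ω u
    have h3 := M.le_excess x κ α 0 (stopTime (M.ruinTime (x + κ) α ω) u) ω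
    have h4 := p.one_lt_δ
    rw [gain, if_pos h1]
    nlinarith
  · exact M.gain_nonneg hκ x α 0 ω u

/-- The first claim time is positive on every path, and the clock charges every interval to the
right of zero. -/
theorem initialGain_pos [IsProbabilityMeasure P] (hκ : 0 < κ) : 0 < M.initialGain κ := by
  rw [pos_iff_ne_zero]
  intro h
  have := isProbabilityMeasure_discountMeasure p.ρ_pos
  have hm : Measurable (Function.uncurry fun (ω : Ω) (u : ℝ≥0) => ENNReal.ofReal
      (if (u : ℝ≥0∞) ≤ M.claimTime 1 ω then (p.δ - 1) * κ else 0)) :=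
    (Measurable.ite (measurableSet_le measurable_snd.coe_nnreal_ennreal
      ((M.measurable_claimTime 1).comp measurable_fst)) measurable_const
      measurable_const).ennreal_ofReal
  have h1 := (lintegral_eq_zero_iff hm.lintegral_prod_right').1 h
  obtain ⟨ω, hω⟩ := h1.exists
  have h2 := (lintegral_eq_zero_iff (hm.comp measurable_prodMk_left)).1 hω
  obtain ⟨s, hs0, hs⟩ := ENNReal.lt_iff_exists_nnreal_btwn.1 (M.claimTime_one_pos ω)
  obtain ⟨u, hu, hu0⟩ := ae_discountMeasure_exists p.ρ_pos h2 (ENNReal.coe_pos.1 hs0)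
  have h3 : (u : ℝ≥0∞) ≤ M.claimTime 1 ω := (ENNReal.coe_lt_coe.2 hu.2).le.trans hs.le
  have h4 := p.one_lt_δ
  have h5 : (p.δ - 1) * κ ≤ 0 := by simpa [h3] using hu0
  nlinarith

/-- The lower bound `initialGain` is the same for all strategies, so the inequality remains strict
after taking the supremum. -/
theorem value_sub_lt [IsProbabilityMeasure P] (hx : 0 ≤ x) (hκ : 0 < κ) :
    M.value (x + κ) - ((p.δ * κ : ℝ) : EReal) < M.value x := by
  obtain ⟨v, hv⟩ := M.exists_value_eq x
  obtain ⟨w, hw⟩ := M.exists_value_eq (x + κ)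
  have hne : M.initialGain κ ≠ ⊤ ∧ M.value (x + κ) ≤
      ((v - (M.initialGain κ).toReal + p.δ * κ : ℝ) : EReal) := by
    have h (α : Strategy Ω) (hα : M.IsAdmissible (x + κ) α)
        (hI : M.expectedInjections (x + κ) α ≠ ⊤) : M.initialGain κ ≠ ⊤ ∧
        M.reward (x + κ) α ≤ ((v - (M.initialGain κ).toReal + p.δ * κ : ℝ) : EReal) := by
      obtain ⟨r, hr, hG, hle⟩ := M.exists_improvement hκ.le hα (Or.inr ⟨hx, rfl⟩) hI
      have h1 := M.initialGain_le_expectedGain hκ.le x α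
      have h2 := ENNReal.toReal_mono hG h1
      refine ⟨ne_top_of_le_ne_top hG h1, ?_⟩
      rw [hv, EReal.coe_le_coe_iff] at hle
      rw [hr, EReal.coe_le_coe_iff]
      linarith
    constructor
    -- An infinite bound would leave only strategies of infinite cost, and the value would be
    -- $-\infty$.
    · by_contra htop
      refine (M.bot_lt_value (x + κ)).ne' (le_bot_iff.1 (iSup₂_le fun α hα => ?_))
      by_cases hI : M.expectedInjections (x + κ) α = ⊤
      · exact (M.reward_eq_bot hI).le
      · exact absurd htop (h α hα hI).1
    · refine iSup₂_le fun α hα => ?_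
      by_cases hI : M.expectedInjections (x + κ) α = ⊤
      · rw [M.reward_eq_bot hI]
        exact bot_le
      · exact (h α hα hI).2
  have hpos := ENNReal.toReal_pos (M.initialGain_pos hκ).ne' hne.1
  have hle := hne.2
  rw [hw, EReal.coe_le_coe_iff] at hle
  rw [hv, hw, ← EReal.coe_sub, EReal.coe_lt_coe_iff]
  linarith

/-! ### Optimal injections -/

/-- With $\kappa=0$ the modified strategy starts from the same reserve and competes with `α` itself,
so optimality leaves no room for a gain. -/
theorem expectedGain_eq_zero [IsProbabilityMeasure P] (hα : M.IsAdmissible x α)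
    (hopt : M.reward x α = M.value x) (n : ℕ) : M.expectedGain x 0 α n = 0 := by
  have hI : M.expectedInjections x α ≠ ⊤ := fun h =>
    (M.bot_lt_value x).ne' (hopt ▸ M.reward_eq_bot h)
  obtain ⟨r, hr, hG, hle⟩ := M.exists_improvement (x := x) (κ := 0) (α := α) le_rfl
    (by rwa [add_zero]) (n := n) (Or.inl rfl) (by rwa [add_zero])
  rw [add_zero] at hr
  rw [← hopt, hr, EReal.coe_le_coe_iff] at hle
  have h1 := ENNReal.toReal_nonneg (a := M.expectedGain x 0 α n)
  exact ((ENNReal.toReal_eq_zero_iff _).1 (by linarith)).resolve_right hG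

theorem ae_gain_eq_zero [IsProbabilityMeasure P] (hα : M.IsAdmissible x α)
    (hopt : M.reward x α = M.value x) :
    ∀ᵐ ω ∂P, ∀ n, ∀ᵐ u ∂discountMeasure p.ρ, M.gain x 0 α n ω u = 0 := by
  have := isProbabilityMeasure_discountMeasure p.ρ_pos
  refine ae_all_iff.2 fun n => ?_
  have hm : Measurable (Function.uncurry fun ω u => ENNReal.ofReal (M.gain x 0 α n ω u)) :=
    (M.measurable_gain (κ := 0) (by rwa [add_zero]) n).ennreal_ofReal
  filter_upwards [(lintegral_eq_zero_iff hm.lintegral_prod_right').1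
    (M.expectedGain_eq_zero hα hopt n)] with ω hω
  filter_upwards [(lintegral_eq_zero_iff (hm.comp measurable_prodMk_left)).1 hω] with u hu
  exact le_antisymm (ENNReal.ofReal_eq_zero.1 hu) (M.gain_nonneg le_rfl x α n ω u)

theorem gain_eq_zero {n : ℕ} {u : ℝ≥0} (h : M.gain x 0 α n ω u = 0) :
    ((stopTime (M.ruinTime x α ω) u : ℝ≥0∞) ≤ M.claimTime (n + 1) ω →
      M.excess x 0 α n (stopTime (M.ruinTime x α ω) u) ω = 0) ∧
    M.paidInjections x α ω u = α.K (stopTime (M.ruinTime x α ω) u) ω := by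
  have h1 := M.excess_nonneg le_rfl x α n (stopTime (M.ruinTime x α ω) u) ω
  have h2 := M.le_paidInjections x α ω u
  have h3 := p.one_lt_δ
  rw [gain, add_zero] at h
  split_ifs at h with hσ
  · exact ⟨fun _ => by nlinarith, by nlinarith⟩
  · exact ⟨fun h' => absurd h' hσ, by nlinarith⟩

/-- Along a path on which deferring injections yields no gain, no more than the shortfall at the
`n`-th claim is injected before the next claim. -/
theorem injection_eq_of_gain_eq_zero {n : ℕ}
    (h : ∀ᵐ u ∂discountMeasure p.ρ, M.gain x 0 α n ω u = 0) {τ t : ℝ≥0}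
    (hτ : M.claimTime n ω = τ) (hτt : τ ≤ t) (ht : (t : ℝ≥0∞) < M.ruinTime x α ω)
    (hσ : (t : ℝ≥0∞) < M.claimTime (n + 1) ω) :
    ∃ u > t, α.K u ω = α.K τ ω + max 0 (-M.surplus x α τ ω) ∧
      Function.rightLim (fun s => α.K s ω) τ = α.K τ ω + max 0 (-M.surplus x α τ ω) := by
  -- Choose a clock value `u` after `t` but before both ruin and the next claim; there the vanishing
  -- gain says that the excess is zero.
  obtain ⟨r, htr, hr⟩ := ENNReal.lt_iff_exists_nnreal_btwn.1 (lt_min ht hσ)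
  obtain ⟨u, hu, hu0⟩ := ae_discountMeasure_exists p.ρ_pos h (ENNReal.coe_lt_coe.1 htr)
  have hur : (u : ℝ≥0∞) ≤ r := ENNReal.coe_le_coe.2 hu.2.le
  have huT : (u : ℝ≥0∞) ≤ M.ruinTime x α ω := hur.trans (hr.le.trans (min_le_left _ _))
  have h1 := (M.gain_eq_zero hu0).1
  rw [stopTime_of_le huT] at h1
  have h2 := h1 (hur.trans (hr.le.trans (min_le_right _ _)))
  have hτu : τ < u := hτt.trans_lt hu.1
  have hup : α.K u ω ≤ α.K τ ω + max 0 (-M.surplus x α τ ω) := by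
    simp only [excess, excessInjection, hτ, stopTime_coe, min_eq_right hτu.le, add_zero,
      zero_add] at h2
    linarith [le_max_right 0 (α.K u ω - α.K τ ω - max 0 (-M.surplus x α τ ω))]
  -- Solvency right after the claim forces the whole shortfall to be injected at once.
  have hlow : α.K τ ω + max 0 (-M.surplus x α τ ω) ≤
      Function.rightLim (fun s => α.K s ω) τ := by
    have h3 := M.surplusAfter_nonneg ((ENNReal.coe_le_coe.2 hτt).trans_lt ht)
    have h4 : α.K τ ω ≤ Function.rightLim (fun s => α.K s ω) τ :=
      (α.K_mono ω).le_rightLim le_rfl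
    rw [surplusAfter_eq] at h3
    have h5 : max 0 (-M.surplus x α τ ω) ≤
        Function.rightLim (fun s => α.K s ω) τ - α.K τ ω :=
      max_le (by linarith) (by rw [surplus]; linarith)
    linarith
  have hmid : Function.rightLim (fun s => α.K s ω) τ ≤ α.K u ω := (α.K_mono ω).rightLim_le hτu
  exact ⟨u, hu.1, by linarith, by linarith⟩

theorem ae_dK_of_gain_eq_zero
    (h : ∀ n, ∀ᵐ u ∂discountMeasure p.ρ, M.gain x 0 α n ω u = 0) :
    ∀ᵐ t ∂(α.dK ω), ENNReal.ofReal t ≤ M.ruinTime x α ω →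
      M.surplus x α t.toNNReal ω < 0 ∧ M.surplusAfter x α t.toNNReal ω = 0 := by
  set q : ℝ≥0 → Prop := fun t => M.surplus x α t ω < 0 ∧ M.surplusAfter x α t ω = 0 with hq
  set S : ℕ → Set ℝ := fun n => {t | 0 ≤ t ∧ ENNReal.ofReal t < M.ruinTime x α ω ∧
    M.N t.toNNReal ω = n ∧ ¬ q t.toNNReal} with hS
  have hsub : {t : ℝ | ¬ (ENNReal.ofReal t ≤ M.ruinTime x α ω → q t.toNNReal)} ⊆
      Iio 0 ∪ {t : ℝ | 0 ≤ t ∧ ENNReal.ofReal t = M.ruinTime x α ω} ∪ ⋃ n, S n := by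
    intro t ht
    rw [mem_ofPred_eq, Classical.not_imp] at ht
    rcases lt_or_ge t 0 with h0 | h0
    · exact Or.inl (Or.inl h0)
    · rcases ht.1.eq_or_lt with h1 | h1
      · exact Or.inl (Or.inr ⟨h0, h1⟩)
      · exact Or.inr (mem_iUnion.2 ⟨_, h0, h1, rfl, ht.2⟩)
  refine measure_mono_null hsub (measure_union_null (measure_union_null ?_ ?_)
    (measure_iUnion_null fun n => ?_))
  · exact pathMeasure_Iio_zero _ _
  · by_cases hT : M.ruinTime x α ω = ⊤
    · refine measure_mono_null (t := ∅) (fun t ht => ?_) measure_empty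
      exact absurd (ht.2.trans hT) ENNReal.ofReal_ne_top
    · obtain ⟨T, hT⟩ : ∃ T : ℝ≥0, (T : ℝ≥0∞) = M.ruinTime x α ω :=
        ⟨_, ENNReal.coe_toNNReal hT⟩
      refine measure_mono_null (t := {(T : ℝ)}) (fun t ht => ?_)
        (pathMeasure_singleton_eq_zero _ _ (α.K_leftContinuous ω) (α.K_zero ω) ?_)
      · have h1 := ht.2
        rw [← hT, ENNReal.ofReal, ENNReal.coe_inj] at h1
        rw [mem_singleton_iff, ← h1, Real.coe_toNNReal t ht.1]
      -- At a clock value beyond ruin the vanishing gain gives $K_{T+}=K_T$, hence no atom at $T$.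
      -- The choice of `n` is immaterial.
      · obtain ⟨u, hu, hu0⟩ := ae_discountMeasure_exists p.ρ_pos (h 0) (lt_add_one T)
        have h1 := (M.gain_eq_zero hu0).2
        rw [paidInjections, stopAfter, ← hT,
          if_neg (not_le.2 (ENNReal.coe_lt_coe.2 hu.1)),
          ENNReal.toNNReal_coe, stopTime_coe, min_eq_right hu.1.le] at h1
        exact h1.le
  -- Injections are controlled only up to some `u` slightly beyond each `t`, so nullity is proved
  -- locally.
  · refine measure_null_of_locally_null _ fun t ht => ?_
    obtain ⟨ht0, htT, htN, -⟩ := ht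
    lift t to ℝ≥0 using ht0
    rw [ENNReal.ofReal_coe_nnreal] at htT
    rw [Real.toNNReal_coe] at htN
    have hτ := M.claimTime_le_iff.2 htN.ge
    have hσ : (t : ℝ≥0∞) < M.claimTime (n + 1) ω :=
      M.lt_claimTime_iff.2 (htN.trans_lt (Nat.lt_succ_self n))
    obtain ⟨τ, hτeq⟩ : ∃ τ : ℝ≥0, (τ : ℝ≥0∞) = M.claimTime n ω :=
      ⟨_, ENNReal.coe_toNNReal (ne_top_of_le_ne_top ENNReal.coe_ne_top hτ)⟩
    rw [← hτeq, ENNReal.coe_le_coe] at hτ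
    obtain ⟨u, htu, hKu, hKτ⟩ := M.injection_eq_of_gain_eq_zero (h n) hτeq.symm hτ htT hσ
    refine ⟨S n ∩ Iio (u : ℝ), inter_mem_nhdsWithin _
      (Iio_mem_nhds (NNReal.coe_lt_coe.2 htu)), ?_⟩
    have hIoo : α.dK ω (Ioo (τ : ℝ) u) = 0 :=
      pathMeasure_Ioo_eq_zero _ _ (α.K_leftContinuous ω) (α.K_zero ω) (hKu.trans hKτ.symm).le
    have hge (s : ℝ) (hs : s ∈ S n) : (τ : ℝ) ≤ s := by
      have h1 := M.claimTime_le_iff.2 (hs.2.2.1.ge)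
      rwa [← hτeq, ENNReal.coe_le_coe, Real.le_toNNReal_iff_coe_le hs.1] at h1
    -- The open interval after the claim is null. Without a shortfall the claim time is no atom
    -- either; with one, the injection there is exactly of the permitted kind, so $\tau$ is not in
    -- the exceptional set.
    rcases le_or_gt 0 (M.surplus x α τ ω) with hX | hX
    · rw [max_eq_left (by linarith), add_zero] at hKτ
      have hτ0 : α.dK ω {(τ : ℝ)} = 0 :=
        pathMeasure_singleton_eq_zero _ _ (α.K_leftContinuous ω) (α.K_zero ω) hKτ.le
      refine measure_mono_null (fun s hs => ?_) (measure_union_null hτ0 hIoo)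
      rcases (hge s hs.1).eq_or_lt with h1 | h1
      · exact Or.inl h1.symm
      · exact Or.inr ⟨h1, hs.2⟩
    · rw [max_eq_right (by linarith)] at hKτ
      have hqτ : q τ := by
        refine ⟨hX, ?_⟩
        rw [surplusAfter_eq, hKτ, surplus]
        ring
      refine measure_mono_null (fun s hs => mem_Ioo.2
        ⟨lt_of_le_of_ne (hge s hs.1) ?_, hs.2⟩) hIoo
      rintro rfl
      exact hs.1.2.2.2 (by rwa [Real.toNNReal_coe])

end HawkesClaims

theorem mainTheorem5 (p : RiskParams) (y : ℝ) (hy : p.b ≤ y)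
    {Ω : Type*} [m : MeasurableSpace Ω] (P : Measure Ω) [IsProbabilityMeasure P]
    (𝔽 : Filtration ℝ≥0 m) (M : HawkesClaims p y P 𝔽) :
    (∀ x κ : ℝ, 0 ≤ x → 0 < κ →
      M.value (x + κ) - ((p.δ * κ : ℝ) : EReal) < M.value x) ∧
    (∀ (x : ℝ) (α : Strategy Ω), M.IsAdmissible x α → M.reward x α = M.value x →
      ∀ᵐ ω ∂P, ∀ᵐ t ∂(α.dK ω), ENNReal.ofReal t ≤ M.ruinTime x α ω →
        M.surplus x α t.toNNReal ω < 0 ∧ M.surplusAfter x α t.toNNReal ω = 0) := by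
  refine ⟨fun x κ hx hκ => M.value_sub_lt hx hκ, fun x α hα hopt => ?_⟩
  filter_upwards [M.ae_gain_eq_zero hα hopt] with ω hω
  exact M.ae_dK_of_gain_eq_zero hω
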